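/- **Setting.** Fix $\gamma\in[0,1]$. An instance $I=(F_1,\dots,F_n)$, $n\ge 1$, is a tuple of probability distributions on $[0,\infty)$ with finite expectation; $X_1,\dots,X_n$ are independent with $X_i\sim F_i$, and $\mathbb{E}[\mathrm{OPT}(I)]=\mathbb{E}[\max_i X_i]$. In the $\gamma$-prophet inequality with random order, an algorithm that knows $I$ observes the items one by one in a uniformly random order $\pi$ (independent of the values), and decides after each observation, possibly with the help of independent randomness, whether to stop. If it stops at step $\tau$, its reward is $\max\{X_{\pi(\tau)},\gamma X_{\pi(\tau-1)},\dots,\gamma X_{\pi(1)}\}$; if it never stops, its reward is $\gamma\max_i X_i$. The competitive ratio $\mathrm{CR}^\gamma(\mathrm{ALG})$ is the infimum of $\mathbb{E}[\mathrm{ALG}^\gamma(I)]/\mathbb{E}[\mathrm{OPT}(I)]$ over all instances $I$ with $\mathbb{E}[\mathrm{OPT}(I)]>0$. **Theorem.** (1) Every algorithm $\mathrm{ALG}$ satisfies $$\mathrm{CR}^\gamma(\mathrm{ALG})\le(1-\gamma)^{3/2}\bigl(\sqrt{3-\gamma}-\sqrt{1-\gamma}\bigr)+\gamma .$$ (2)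 The equation $1-(1-\gamma)p=\frac{1-p}{-\log p}$ (the right-hand side being $1$, its limit, at $p=1$) has a unique solution $p_\gamma\in(0,1]$. (3) On every instance $I$ for which $\theta\in[0,\infty]$ satisfies $\Pr(\max_i X_i\le\theta)=p_\gamma$, the single-threshold algorithm that stops at the first value larger than $\theta$ has expected reward at least $(1-(1-\gamma)p_\gamma)\,\mathbb{E}[\mathrm{OPT}(I)]$. If the distributions are continuous (atomless), such a $\theta$ exists. (4) For arbitrary distributions the same holds with stochastic tie-breaking. Let $U_1,\dots,U_n$ be independent, uniform on $[0,1]$ and independent of the $X_i$. For every instance there are $\theta\in[0,\infty]$ and $u\in[0,1]$ such that $\Pr\bigl(\text{for all } i:\ X_i<\theta,\text{ or } X_i=\theta \text{ and } U_i\le u\bigr)=p_\gamma$. For every choice of such $(\theta,u)$ as a function of the instance, the single-threshold algorithm that stops at the first value larger than $\theta$, and accepts a value equal to $\theta$ with probability $1-u$ independently of everything else, satisfies $\mathrm{CR}^\gamma\ge 1-(1-\gamma)p_\gamma$. -/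

import Mathlib

open MeasureTheory
open scoped NNReal ENNReal

noncomputable section

namespace RandomOrderProphet

/-- An instance: a nonempty tuple `(F 0, …, F (n - 1))` of probability distributions on `[0, ∞)`
with finite expectation. -/
structure ProphetInstance where
  n : ℕ
  n_pos : 0 < n
  F : Fin n → ProbabilityMeasure ℝ≥0
  finite_mean : ∀ i, ∫⁻ x, (x : ℝ≥0∞) ∂(F i : Measure ℝ≥0) ≠ ⊤

namespace ProphetInstance

/-- The joint law of the independent values `X i ∼ F i`. -/
def law (I : ProphetInstance) : Measure (Fin I.n → ℝ≥0) :=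
  Measure.pi fun i => (I.F i : Measure ℝ≥0)

/-- `max_i x i`. -/
def maxValue (I : ProphetInstance) (x : Fin I.n → ℝ≥0) : ℝ≥0 :=
  Finset.univ.sup x

/-- `E[OPT(I)] = E[max_i X i]`. -/
def opt (I : ProphetInstance) : ℝ≥0∞ :=
  ∫⁻ x, (I.maxValue x : ℝ≥0∞) ∂I.law

/-- All the distributions are continuous (atomless). -/
def IsContinuous (I : ProphetInstance) : Prop :=
  ∀ i x, (I.F i : Measure ℝ≥0) {x} = 0

/-- The internal randomness of an algorithm: uniform variables on `[0, 1]`, independent of each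
other, of the values and of the observation order. -/
abbrev Seed (I : ProphetInstance) : Type := Fin I.n → unitInterval

/-- What has been observed up to and including step `t`: for every step `s ≤ t` the index of the
item observed at step `s` and its value. -/
abbrev History (I : ProphetInstance) (t : Fin I.n) : Type := Set.Iic t → Fin I.n × ℝ≥0

/-- The history at step `t` when the values are `x` and item `π s` is observed at step `s`. -/
def history (I : ProphetInstance) (π : Equiv.Perm (Fin I.n)) (x : Fin I.n → ℝ≥0) (t : Fin I.n) :
    I.History t :=
  fun s => (π s, x (π s))

/-- The reward in the `γ`-prophet inequality of stopping at step `τ`: the maximum of the current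
value and of `γ` times the values rejected before. `τ = ⊤` means that the algorithm never stops,
its reward is then `γ` times the maximal value. -/
def payoff (I : ProphetInstance) (γ : ℝ≥0) (π : Equiv.Perm (Fin I.n)) (x : Fin I.n → ℝ≥0)
    (τ : WithTop (Fin I.n)) : ℝ≥0 :=
  Finset.univ.sup fun s : Fin I.n =>
    if (s : WithTop (Fin I.n)) < τ then γ * x (π s)
    else if (s : WithTop (Fin I.n)) = τ then x (π s)
    else 0

end ProphetInstance

/-- A (possibly randomized) online algorithm. It knows the instance `I`, and at every step `t` it
decides whether to stop from its seed and from what has been observed so far. -/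
structure Algorithm where
  accept : (I : ProphetInstance) → (t : Fin I.n) → I.Seed → I.History t → Bool
  measurable_accept : ∀ (I : ProphetInstance) (t : Fin I.n),
    Measurable fun q : I.Seed × I.History t => accept I t q.1 q.2

namespace Algorithm

/-- The stopping time: the first step at which the rule says to stop, `⊤` if there is none. -/
def stoppingTime (A : Algorithm) (I : ProphetInstance) (ω : I.Seed) (π : Equiv.Perm (Fin I.n))
    (x : Fin I.n → ℝ≥0) : WithTop (Fin I.n) :=
  (Finset.univ.filter fun t : Fin I.n => A.accept I t ω (I.history π x t) = true).min

/-- `E[ALG^γ(I)]` with a uniformly random observation order, where the seed, the values and the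
observation order are independent. -/
def expectedReward (A : Algorithm) (γ : ℝ≥0) (I : ProphetInstance) : ℝ≥0∞ :=
  ∫⁻ ω : I.Seed, ∫⁻ x,
    (∑ π : Equiv.Perm (Fin I.n), (I.payoff γ π x (A.stoppingTime I ω π x) : ℝ≥0∞)) /
      (I.n.factorial : ℝ≥0∞) ∂I.law

/-- The competitive ratio: the infimum of `E[ALG^γ(I)] / E[OPT(I)]` over all instances (for which
this quotient makes sense). -/
def competitiveRatio (A : Algorithm) (γ : ℝ≥0) : ℝ≥0∞ :=
  ⨅ (I : ProphetInstance) (_ : I.opt ≠ 0), A.expectedReward γ I / I.opt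

end Algorithm

/-- The single-threshold algorithm: on the instance `I` it stops at the first value larger than
`θ I`; a value equal to `θ I` is accepted with probability `1 - u I`, independently of everything
else. With `u = 1` it accepts exactly the values larger than `θ I`. -/
def singleThreshold (θ : ProphetInstance → ℝ≥0∞) (u : ProphetInstance → unitInterval) :
    Algorithm where
  accept I t ω h :=
    decide (θ I < ((h ⟨t, Set.self_mem_Iic⟩).2 : ℝ≥0∞) ∨ (((h ⟨t, Set.self_mem_Iic⟩).2 : ℝ≥0∞) = θ I ∧ u I < ω t))
  measurable_accept I t := by
    have h1 : Measurable fun q : I.Seed × I.History t => ((q.2 ⟨t, Set.self_mem_Iic⟩).2 : ℝ≥0∞) := by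
      fun_prop
    have h2 : Measurable fun q : I.Seed × I.History t => q.1 t := by fun_prop
    refine measurable_to_bool ?_
    have : (fun q : I.Seed × I.History t =>
        decide (θ I < ((q.2 ⟨t, Set.self_mem_Iic⟩).2 : ℝ≥0∞) ∨
          (((q.2 ⟨t, Set.self_mem_Iic⟩).2 : ℝ≥0∞) = θ I ∧ u I < q.1 t))) ⁻¹' {true} =
        {q | θ I < ((q.2 ⟨t, Set.self_mem_Iic⟩).2 : ℝ≥0∞)} ∪
          ({q | ((q.2 ⟨t, Set.self_mem_Iic⟩).2 : ℝ≥0∞) = θ I} ∩ {q | u I < q.1 t}) := by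
      ext q; simp
    rw [this]
    exact (measurableSet_lt measurable_const h1).union
      ((measurableSet_eq_fun h1 measurable_const).inter (measurableSet_lt measurable_const h2))

namespace ProphetInstance

/-- `P(max_i X i ≤ θ)`. -/
def probMaxLE (I : ProphetInstance) (θ : ℝ≥0∞) : ℝ≥0∞ :=
  I.law {x | (I.maxValue x : ℝ≥0∞) ≤ θ}

/-- `P(max_i (X i, U i) ≤ (θ, u))` for the lexicographic order, where the `U i` are independent
and uniform on `[0, 1]`: the version of `P(max_i X i ≤ θ)` with stochastic tie-breaking. It is
equal to it when `u = 1` or when the distributions are continuous. -/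
def probMaxLETie (I : ProphetInstance) (θ : ℝ≥0∞) (u : unitInterval) : ℝ≥0∞ :=
  (I.law.prod (volume : Measure (Fin I.n → unitInterval)))
    {q | ∀ i, (q.1 i : ℝ≥0∞) < θ ∨ ((q.1 i : ℝ≥0∞) = θ ∧ q.2 i ≤ u)}

end ProphetInstance

/-- The function `p ↦ (1 - p) / (- log p)` on `(0, 1]`, with its limit `1` as value at `p = 1`. -/
def ratioLog (p : ℝ) : ℝ :=
  if p = 1 then 1 else (1 - p) / (-Real.log p)

/-- `p ∈ (0, 1]` solves `1 - (1 - γ) p = (1 - p) / (- log p)`. -/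
def IsPGamma (γ : ℝ≥0) (p : ℝ) : Prop :=
  0 < p ∧ p ≤ 1 ∧ 1 - (1 - (γ : ℝ)) * p = ratioLog p

end RandomOrderProphet

end

namespace RandomOrderProphet

/-! Write `b = 1 - γ`, `r = 1 - b * p`, and let `p` be the probability that a threshold rule accepts
nothing.

Guarantee. If the rule stops at an item of value `x`, the reward is at least `x = θ + (x - θ)`. If
it never stops, all values are at most `θ` and the reward is `γ` times their maximum. Since the
maximum is at most `θ + ∑ i, (x i - θ)⁺`, these two cases combine into one pointwise inequality
(`singleThreshold_pointwise`). In expectation its threshold terms cancel, and what remains to be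
shown is that, for each item `i`, the chance that nothing is accepted before `i` is at least `r`.
This chance is the average over orders of the product of the rejection probabilities `q j` of the
items before `i`. By convexity of `exp` it does not increase when the `q j`, `j ≠ i`, are replaced
by their geometric mean `ρ`. It is then the average of `1, ρ, …, ρ ^ (n - 1)`, which is at least
`∫₀¹ ρ ^ ((n - 1) * t) dt = ratioLog (ρ ^ (n - 1)) ≥ ratioLog p` (`ratioLog_pow_le`,
`ratioLog_prod_le_sum_perm`). The equation for `p_γ` says exactly that `ratioLog p = r`. A suitable
`(θ, u)` exists because tie-breaking fills the jumps of the distribution function of the maximum.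

Upper bound. One item has the constant value `a`; each of `N` others is `N` with probability `1 / N
^ 2` and `0` otherwise. As `N → ∞`, the optimum tends to `1 + a`. Until a large value shows up, an
algorithm learns only where the constant item sits. If that is at the fraction `y` of the sequence,
stopping there yields about `a + y`, and passing on yields at most about `γ * a + 1`
(`IsHard.stop_bound`). Averaging the better option over `y` bounds the reward by `γ * a + 1 + (b *
a) ^ 2 / 2`, and the best `a` gives the stated constant (`optimal_constant`). -/

/-! ### The equation that defines `p_γ`. -/

theorem ratioLog_one : ratioLog 1 = 1 := by simp [ratioLog]

theorem ratioLog_of_lt_one {p : ℝ} (h : p < 1) : ratioLog p = (1 - p) / (-Real.log p) := by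
  simp [ratioLog, h.ne]

theorem ratioLog_lt_one {p : ℝ} (h0 : 0 < p) (h : p < 1) : ratioLog p < 1 := by
  rw [ratioLog_of_lt_one h, div_lt_one (by linarith [Real.log_neg h0 h])]
  linarith [Real.log_lt_sub_one_of_pos h0 h.ne]

/-- For `p < 1` the reciprocal of `ratioLog p` is the slope of the chord of `log` between `p` and
`1`, and these slopes decrease strictly because `log` is strictly concave. -/
theorem ratioLog_strictMonoOn : StrictMonoOn ratioLog (Set.Ioc 0 1) := by
  intro p hp q hq hpq
  have hp1 : p < 1 := hpq.trans_le hq.2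
  rcases hq.2.eq_or_lt with rfl | hq1
  · rw [ratioLog_one]; exact ratioLog_lt_one hp.1 hp1
  have h := strictConcaveOn_log_Ioi.slope_anti_adjacent (x := p) (y := q) (z := 1) hp.1
    (Set.mem_Ioi.2 one_pos) hpq hq1
  have hlp := Real.log_neg hp.1 hp1
  have hlq := Real.log_neg hq.1 hq1
  rw [ratioLog_of_lt_one hp1, ratioLog_of_lt_one hq1, div_lt_div_iff₀ (by linarith) (by linarith)]
  rw [Real.log_one, div_lt_div_iff₀ (by linarith) (by linarith)] at h
  nlinarith

theorem existsUnique_isPGamma {γ : ℝ≥0} (hγ : γ ≤ 1) : ∃! p : ℝ, IsPGamma γ p := by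
  have hγ' : (γ : ℝ) ≤ 1 := by exact_mod_cast hγ
  refine existsUnique_of_exists_of_unique ?_ ?_
  · rcases hγ'.eq_or_lt with h1 | h1
    · exact ⟨1, one_pos, le_rfl, by rw [ratioLog_one, h1]; ring⟩
    have hγ0 : (0 : ℝ) ≤ γ := γ.2
    set b : ℝ := 1 - γ with hb
    have hb0 : 0 < b := by rw [hb]; linarith
    have hb1 : b ≤ 1 := by rw [hb]; linarith
    -- `g` is the equation with its denominator cleared. It always vanishes at `1`, so the
    -- intermediate value theorem needs a right endpoint strictly below `1`; one exists because the
    -- derivative of `g` at `1` is `-b < 0`. For `b = 0` the only root is `1`, hence the separate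
    -- case above.
    set g : ℝ → ℝ := fun p => (1 - p) + (1 - b * p) * Real.log p with hg
    -- a point where `g` is positive
    obtain ⟨s, hs0, hs1, hsg⟩ : ∃ s : ℝ, 1 / 2 ≤ s ∧ s < 1 ∧ 0 < g s := by
      refine ⟨1 - b / 4, by linarith, by linarith, ?_⟩
      have hs : (0 : ℝ) < 1 - b / 4 := by linarith
      have hl := Real.one_sub_inv_le_log_of_pos hs
      have e : 1 - (1 - b / 4)⁻¹ = -(b / 4) / (1 - b / 4) := by
        rw [eq_div_iff hs.ne', sub_mul, inv_mul_cancel₀ hs.ne']; ring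
      rw [e, div_le_iff₀ hs] at hl
      simp only [hg]
      have h3 : 0 < 1 - b * (1 - b / 4) := by nlinarith
      have : 0 < (1 - b / 4) * ((1 - (1 - b / 4)) + (1 - b * (1 - b / 4)) * Real.log (1 - b / 4)) := by
        nlinarith [mul_le_mul_of_nonneg_left hl h3.le, mul_pos hb0 hb0, mul_pos hb0 (mul_pos hb0 hb0)]
      exact pos_of_mul_pos_right this hs.le |>.trans_le le_rfl
    -- a point where `g` is negative
    have hlog : Real.log (Real.exp (-4)) = -4 := Real.log_exp _
    have he : Real.exp (-4) < 1 / 2 := by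
      have := Real.add_one_lt_exp (x := (4 : ℝ)) (by norm_num)
      rw [Real.exp_neg, inv_lt_comm₀ (Real.exp_pos _) (by norm_num)]
      linarith
    have hne : g (Real.exp (-4)) ≤ 0 := by
      simp only [hg, hlog]
      nlinarith [Real.exp_pos (-4)]
    have hcont : ContinuousOn g (Set.Icc (Real.exp (-4)) s) := by
      have : ContinuousOn Real.log (Set.Icc (Real.exp (-4)) s) :=
        Real.continuousOn_log.mono fun x hx => (lt_of_lt_of_le (Real.exp_pos _) hx.1).ne'
      simp only [hg]
      fun_prop
    obtain ⟨p, hp, hgp⟩ := intermediate_value_Icc (by linarith) hcont ⟨hne, hsg.le⟩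
    have hp0 : 0 < p := lt_of_lt_of_le (Real.exp_pos _) hp.1
    have hp1 : p < 1 := hp.2.trans_lt hs1
    refine ⟨p, hp0, hp1.le, ?_⟩
    have hl := Real.log_neg hp0 hp1
    rw [ratioLog_of_lt_one hp1, eq_div_iff (by linarith)]
    simp only [hg] at hgp
    rw [← hb]
    linarith
  · rintro p q ⟨hp0, hp1, hp⟩ ⟨hq0, hq1, hq⟩
    by_contra hne
    wlog h : p < q generalizing p q
    · exact this q p hq0 hq1 hq hp0 hp1 hp (Ne.symm hne) (lt_of_le_of_ne (not_lt.1 h) (Ne.symm hne))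
    -- The left-hand side of the equation is nonincreasing in `p`, the right-hand side strictly
    -- increasing.
    have := ratioLog_strictMonoOn ⟨hp0, hp1⟩ ⟨hq0, hq1⟩ h
    rw [← hp, ← hq] at this
    nlinarith

/-! ### Averages over a uniformly random order. -/

/-- The average of a geometric progression dominates the corresponding average over `[0, 1]`. -/
theorem ratioLog_pow_le {r : ℝ} (h0 : 0 < r) (h1 : r ≤ 1) (m : ℕ) :
    ratioLog (r ^ m) * (m + 1) ≤ ∑ k ∈ Finset.range (m + 1), r ^ k := by
  rcases h1.eq_or_lt with rfl | h1
  · simp [ratioLog_one]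
  rcases Nat.eq_zero_or_pos m with rfl | hm
  · simp [ratioLog_one]
  have hmR : (0 : ℝ) < m := by exact_mod_cast hm
  have hl := Real.log_neg h0 h1
  have hpow : r ^ m < 1 := pow_lt_one₀ h0.le h1 hm.ne'
  rw [ratioLog_of_lt_one hpow, Real.log_pow, geom_sum_eq h1.ne]
  -- `F` is an antiderivative of `(1 - t + t * r) ^ m - r ^ (m * t)`. Over `[0, 1]` the first term
  -- integrates to the average of `1, r, …, r ^ m` and the second to `ratioLog (r ^ m)`, so it
  -- suffices to compare the integrands.
  set F : ℝ → ℝ := fun t => -(1 - t + t * r) ^ (m + 1) / ((m + 1) * (1 - r))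
    + Real.exp (m * Real.log r * t) / (-(m * Real.log r)) with hF
  have hderiv : ∀ t, HasDerivAt F ((1 - t + t * r) ^ m - Real.exp (m * Real.log r * t)) t := by
    intro t
    have a1 : HasDerivAt (fun t : ℝ => 1 - t + t * r) (-1 + 1 * r) t :=
      ((hasDerivAt_id t).const_sub 1).add ((hasDerivAt_id t).mul_const r)
    have a2 := ((a1.pow (m + 1)).neg).div_const ((m + 1) * (1 - r))
    have a3 : HasDerivAt (fun t : ℝ => Real.exp (m * Real.log r * t))
        (Real.exp (m * Real.log r * t) * (m * Real.log r * 1)) t :=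
      ((hasDerivAt_id t).const_mul (m * Real.log r)).exp
    refine (a2.add (a3.div_const (-(m * Real.log r)))).congr_deriv ?_
    have : (1 : ℝ) - r ≠ 0 := by linarith
    have : (m : ℝ) * Real.log r ≠ 0 := mul_ne_zero hmR.ne' hl.ne
    have : Real.log r ≠ 0 := hl.ne
    push_cast
    field_simp
    ring
  have hmono : MonotoneOn F (Set.Icc 0 1) := by
    refine monotoneOn_of_deriv_nonneg (convex_Icc _ _)
      (fun t _ => (hderiv t).continuousAt.continuousWithinAt)
      (fun t _ => (hderiv t).differentiableAt.differentiableWithinAt) ?_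
    intro t ht
    rw [interior_Icc] at ht
    rw [(hderiv t).deriv, sub_nonneg]
    have e : Real.exp (m * Real.log r * t) = (r ^ t) ^ m := by
      rw [Real.rpow_def_of_pos h0, ← Real.exp_nat_mul]; ring_nf
    rw [e]
    refine pow_le_pow_left₀ (Real.rpow_nonneg h0.le _) ?_ _
    -- Bernoulli's inequality for exponents in `[0, 1]`: `r ^ t ≤ 1 + t * (r - 1)`.
    have := _root_.rpow_one_add_le_one_add_mul_self (s := r - 1) (by linarith) ht.1.le ht.2.le
    rw [show 1 + (r - 1) = r by ring] at this
    linarith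
  have hle := hmono (Set.left_mem_Icc.2 zero_le_one) (Set.right_mem_Icc.2 zero_le_one) zero_le_one
  simp only [hF] at hle
  have e : Real.exp (m * Real.log r * 1) = r ^ m := by
    rw [mul_one, Real.exp_nat_mul, Real.exp_log h0]
  rw [e] at hle
  norm_num at hle
  have hr1 : 0 < 1 - r := by linarith
  have key : (1 - r ^ m) / (-(m * Real.log r)) ≤ (1 - r ^ (m + 1)) / ((m + 1) * (1 - r)) := by
    have e1 : (1 - r ^ m) / (-(m * Real.log r)) = 1 / (-(m * Real.log r)) - r ^ m / (-(m * Real.log r)) := by ring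
    have e2 : (1 - r ^ (m + 1)) / ((m + 1) * (1 - r)) =
      1 / ((m + 1) * (1 - r)) - r ^ (m + 1) / ((m + 1) * (1 - r)) := by ring
    rw [e1, e2]
    have t1 : -r ^ (m + 1) / ((m + 1) * (1 - r)) = - (r ^ (m + 1) / ((m + 1) * (1 - r))) := by ring
    have t2 : -(r ^ m / (m * Real.log r)) = r ^ m / (-(m * Real.log r)) := by rw [div_neg]
    have t3 : -1 / ((m + 1) * (1 - r)) = - (1 / ((m + 1) * (1 - r))) := by ring
    have t4 : 1 / (-(m * Real.log r)) = -((Real.log r)⁻¹ * (m : ℝ)⁻¹) := by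
      rw [div_neg, one_div, mul_inv, mul_comm]
    rw [t1, t3] at hle
    rw [t4, ← t2]
    linarith
  have : (1 - r ^ (m + 1)) / ((m + 1) * (1 - r)) * (m + 1) = (r ^ (m + 1) - 1) / (r - 1) := by
    have : r - 1 ≠ 0 := by linarith
    have : 1 - r ≠ 0 := by linarith
    field_simp
    ring
  rw [← this]
  exact mul_le_mul_of_nonneg_right key (by positivity)

/-- The position of an item is uniformly distributed: composing the order with a swap of `i` and `j`
exchanges their positions, so all items give the same sum. -/
theorem sum_perm_symm_apply {n : ℕ} (i : Fin n) (f : Fin n → ℝ) :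
    ∑ π : Equiv.Perm (Fin n), f (π.symm i) = (n.factorial / n : ℝ) * ∑ k, f k := by
  have hn : (n : ℝ) ≠ 0 := by
    have := i.pos
    positivity
  have h : ∀ j, ∑ π : Equiv.Perm (Fin n), f (π.symm j) = ∑ π : Equiv.Perm (Fin n), f (π.symm i) := by
    intro j
    refine Fintype.sum_equiv (Equiv.mulLeft (Equiv.swap i j)) _ _ fun π => ?_
    change _ = f ((Equiv.swap i j * π).symm i)
    congr 1
    rw [Equiv.eq_symm_apply]
    simp
  have h2 : ∑ j, ∑ π : Equiv.Perm (Fin n), f (π.symm j) = n.factorial * ∑ k, f k := by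
    rw [Finset.sum_comm]
    simp only [Equiv.sum_comp]
    simp [Fintype.card_perm]
  rw [Finset.sum_congr rfl fun j _ => h j] at h2
  simp only [Finset.sum_const, Finset.card_univ, Fintype.card_fin, nsmul_eq_mul] at h2
  field_simp
  linarith

theorem card_filter_symm_lt {n : ℕ} (π : Equiv.Perm (Fin n)) (k : Fin n) :
    (Finset.univ.filter fun j => π.symm j < k).card = (k : ℕ) := by
  have : (Finset.univ.filter fun j => π.symm j < k) = (Finset.Iio k).map π.toEmbedding := by
    ext j
    simp only [Finset.mem_filter, Finset.mem_univ, true_and, Finset.mem_map, Finset.mem_Iio]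
    exact ⟨fun h => ⟨_, h, by simp⟩, by rintro ⟨a, ha, rfl⟩; simpa using ha⟩
  rw [this, Finset.card_map, Fin.card_Iio]

/-- The probability that, in a uniformly random order, no item is accepted before item `i`. -/
theorem ratioLog_prod_le_sum_perm {n : ℕ} (i : Fin n) (q : Fin n → ℝ) (h0 : ∀ j, 0 < q j)
    (h1 : ∀ j, q j ≤ 1) :
    ratioLog (∏ j, q j) * n.factorial ≤
      ∑ π : Equiv.Perm (Fin n), ∏ j, if π.symm j < π.symm i then q j else 1 := by
  obtain ⟨m, rfl⟩ : ∃ m, n = m + 1 := ⟨n - 1, by have := i.pos; omega⟩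
  set O := Finset.univ.erase i with hO
  have hcard : O.card = m := by simp [hO]
  -- The mean of `log (q j)` over the items other than `i`, so that `r = exp l` is their geometric
  -- mean. For `m = 0` the quotient is `0` and `r = 1`.
  set l : ℝ := (∑ j ∈ O, Real.log (q j)) / m with hl
  have hml : m * l = ∑ j ∈ O, Real.log (q j) := by
    rcases Nat.eq_zero_or_pos m with rfl | hm
    · have : O = ∅ := Finset.card_eq_zero.1 hcard
      simp [this]
    · rw [hl]; field_simp
  set r := Real.exp l with hr
  have hS : ∑ j ∈ O, (Real.log (q j) - l) = 0 := by
    rw [Finset.sum_sub_distrib, Finset.sum_const, hcard, nsmul_eq_mul, hml, sub_self]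
  have hr1 : r ≤ 1 := Real.exp_le_one_iff.2 <| div_nonpos_of_nonpos_of_nonneg
    (Finset.sum_nonpos fun j _ => Real.log_nonpos (h0 j).le (h1 j)) (Nat.cast_nonneg _)
  have hrm : r ^ m = ∏ j ∈ O, q j := by
    rw [hr, ← Real.exp_nat_mul, hml, Real.exp_sum]
    exact Finset.prod_congr rfl fun j _ => Real.exp_log (h0 j)
  -- the tangent bound for a single order
  have hper : ∀ π : Equiv.Perm (Fin (m + 1)),
      r ^ (π.symm i : ℕ) + ∑ j ∈ O, (Real.log (q j) - l) *
        (if π.symm j < π.symm i then r ^ (π.symm i : ℕ) else 0) ≤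
      ∏ j, if π.symm j < π.symm i then q j else 1 := by
    intro π
    have hfil : (Finset.univ.filter fun j => π.symm j < π.symm i) =
        O.filter fun j => π.symm j < π.symm i := by
      ext j
      simp only [hO, Finset.mem_filter, Finset.mem_univ, true_and, Finset.mem_erase, and_true]
      exact ⟨fun h => ⟨by rintro rfl; exact lt_irrefl _ h, h⟩, fun h => h.2⟩
    have hc := card_filter_symm_lt π (π.symm i)
    rw [hfil] at hc
    rw [← Finset.prod_filter, hfil]
    have e1 : ∏ j ∈ O.filter (fun j => π.symm j < π.symm i), q j =
        r ^ (π.symm i : ℕ) *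
          Real.exp (∑ j ∈ O.filter (fun j => π.symm j < π.symm i), (Real.log (q j) - l)) := by
      rw [Finset.sum_sub_distrib, Finset.sum_const, hc, nsmul_eq_mul, Real.exp_sub, Real.exp_sum,
        Real.exp_nat_mul, ← hr, mul_div_cancel₀ _ (pow_pos (Real.exp_pos _) _).ne']
      exact Finset.prod_congr rfl fun j _ => (Real.exp_log (h0 j)).symm
    rw [e1]
    have e2 : ∑ j ∈ O, (Real.log (q j) - l) *
        (if π.symm j < π.symm i then r ^ (π.symm i : ℕ) else 0) = r ^ (π.symm i : ℕ) *
        ∑ j ∈ O.filter (fun j => π.symm j < π.symm i), (Real.log (q j) - l) := by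
      rw [Finset.mul_sum, Finset.sum_filter]
      exact Finset.sum_congr rfl fun j _ => by split_ifs <;> ring
    rw [e2]
    have := Real.add_one_le_exp
      (∑ j ∈ O.filter (fun j => π.symm j < π.symm i), (Real.log (q j) - l))
    have hp : 0 ≤ r ^ (π.symm i : ℕ) := pow_nonneg (Real.exp_pos _).le _
    nlinarith
  -- Swapping `j` and `j'` in the order leaves the position of `i` unchanged.
  have hsym : ∀ j ∈ O, ∀ j' ∈ O,
      ∑ π : Equiv.Perm (Fin (m + 1)), (if π.symm j < π.symm i then r ^ (π.symm i : ℕ) else 0) =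
      ∑ π : Equiv.Perm (Fin (m + 1)), (if π.symm j' < π.symm i then r ^ (π.symm i : ℕ) else 0) := by
    intro j hj j' hj'
    refine Fintype.sum_equiv (Equiv.mulLeft (Equiv.swap j j')) _ _ fun π => ?_
    have hi : (Equiv.swap j j' * π).symm i = π.symm i := by
      rw [Equiv.symm_apply_eq, Equiv.Perm.mul_apply, Equiv.apply_symm_apply,
        Equiv.swap_apply_of_ne_of_ne (Finset.ne_of_mem_erase hj).symm
          (Finset.ne_of_mem_erase hj').symm]
    have hj2 : (Equiv.swap j j' * π).symm j' = π.symm j := by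
      rw [Equiv.symm_apply_eq]; simp
    simp only [Equiv.coe_mulLeft, hi, hj2]
  -- By symmetry all deviations `log (q j) - l` carry the same total weight, and they sum to zero:
  -- the first-order terms of the tangent bound vanish on average.
  have hzero : ∑ π : Equiv.Perm (Fin (m + 1)), ∑ j ∈ O, (Real.log (q j) - l) *
        (if π.symm j < π.symm i then r ^ (π.symm i : ℕ) else 0) = 0 := by
    rw [Finset.sum_comm]
    simp only [← Finset.mul_sum]
    rcases O.eq_empty_or_nonempty with he | ⟨j', hj'⟩
    · simp [he]
    rw [Finset.sum_congr rfl fun j hj => by rw [hsym j hj j' hj'], ← Finset.sum_mul, hS, zero_mul]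
  have hmono : ratioLog (∏ j, q j) ≤ ratioLog (r ^ m) := by
    refine ratioLog_strictMonoOn.monotoneOn
      ⟨Finset.prod_pos fun j _ => h0 j, Finset.prod_le_one (fun j _ => (h0 j).le) fun j _ => h1 j⟩
      ⟨pow_pos (Real.exp_pos _) _, pow_le_one₀ (Real.exp_pos _).le hr1⟩ ?_
    rw [hrm, ← Finset.mul_prod_erase _ _ (Finset.mem_univ i)]
    exact mul_le_of_le_one_left (Finset.prod_nonneg fun j _ => (h0 j).le) (h1 i)
  calc ratioLog (∏ j, q j) * (m + 1).factorial
      ≤ ratioLog (r ^ m) * (m + 1).factorial := mul_le_mul_of_nonneg_right hmono (by positivity)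
    _ = ratioLog (r ^ m) * (m + 1) * m.factorial := by rw [Nat.factorial_succ]; push_cast; ring
    _ ≤ (∑ k ∈ Finset.range (m + 1), r ^ k) * m.factorial :=
        mul_le_mul_of_nonneg_right (ratioLog_pow_le (Real.exp_pos _) hr1 m) (by positivity)
    _ = ∑ π : Equiv.Perm (Fin (m + 1)), r ^ (π.symm i : ℕ) := by
        rw [sum_perm_symm_apply i fun k : Fin (m + 1) => r ^ (k : ℕ),
          Fin.sum_univ_eq_sum_range fun k => r ^ k, Nat.factorial_succ]
        push_cast
        field_simp
    _ ≤ _ := by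
        rw [← add_zero (∑ π : Equiv.Perm (Fin (m + 1)), r ^ (π.symm i : ℕ)), ← hzero,
          ← Finset.sum_add_distrib]
        exact Finset.sum_le_sum fun π _ => hper π


/-! ### Independence, rejection probabilities and elementary bounds. -/

theorem lintegral_pi_prod {ι : Type*} [Fintype ι] {α : ι → Type*} [∀ i, MeasurableSpace (α i)]
    (μ : ∀ i, Measure (α i)) [∀ i, IsProbabilityMeasure (μ i)] (f : ∀ i, α i → ℝ≥0∞)
    (hf : ∀ i, Measurable (f i)) :
    ∫⁻ x, ∏ i, f i (x i) ∂Measure.pi μ = ∏ i, ∫⁻ x, f i x ∂μ i := by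
  rw [ProbabilityTheory.lintegral_prod_eq_prod_lintegral_of_indepFun Finset.univ
    (fun i (x : ∀ i, α i) => f i (x i))
    (ProbabilityTheory.iIndepFun_pi fun i => (hf i).aemeasurable)
    fun i => (hf i).comp (measurable_pi_apply i)]
  exact Finset.prod_congr rfl fun i _ => (measurePreserving_eval μ i).lintegral_comp (hf i)

namespace ProphetInstance

instance (I : ProphetInstance) : IsProbabilityMeasure I.law := by
  unfold law; infer_instance

theorem lintegral_law_eval (I : ProphetInstance) (i : Fin I.n) {f : ℝ≥0 → ℝ≥0∞}
    (hf : Measurable f) : ∫⁻ x, f (x i) ∂I.law = ∫⁻ x, f x ∂(I.F i : Measure ℝ≥0) :=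
  (measurePreserving_eval (fun i => (I.F i : Measure ℝ≥0)) i).lintegral_comp hf

/-- Fubini for functions that factor over the items, when item `j` uses the seed of step `e j`. -/
theorem lintegral_seed_prod_law (I : ProphetInstance) (e : Equiv.Perm (Fin I.n))
    (g : Fin I.n → unitInterval × ℝ≥0 → ℝ≥0∞) (hg : ∀ j, Measurable (g j)) :
    ∫⁻ z : I.Seed × (Fin I.n → ℝ≥0), ∏ j, g j (z.1 (e j), z.2 j)
        ∂((volume : Measure I.Seed).prod I.law) =
      ∏ j, ∫⁻ w, g j w ∂((volume : Measure unitInterval).prod (I.F j : Measure ℝ≥0)) := by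
  have hm : Measurable fun z : I.Seed × (Fin I.n → ℝ≥0) => ∏ j, g j (z.1 (e j), z.2 j) := by
    fun_prop
  rw [lintegral_prod _ hm.aemeasurable]
  have h1 : ∀ ω : I.Seed, ∫⁻ x, ∏ j, g j (ω (e j), x j) ∂I.law =
      ∏ j, ∫⁻ x, g j (ω (e j), x) ∂(I.F j : Measure ℝ≥0) := fun ω =>
    lintegral_pi_prod (fun i => (I.F i : Measure ℝ≥0)) (fun j x => g j (ω (e j), x))
      fun j => by fun_prop
  have h2 : ∀ ω : I.Seed, ∏ j, ∫⁻ x, g j (ω (e j), x) ∂(I.F j : Measure ℝ≥0) =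
      ∏ t, ∫⁻ x, g (e.symm t) (ω t, x) ∂(I.F (e.symm t) : Measure ℝ≥0) := fun ω => by
    rw [← Equiv.prod_comp e fun t => ∫⁻ x, g (e.symm t) (ω t, x) ∂(I.F (e.symm t) : Measure ℝ≥0)]
    simp only [Equiv.symm_apply_apply]
  simp only [h1, h2]
  rw [volume_pi, lintegral_pi_prod (fun _ : Fin I.n => (volume : Measure unitInterval))
    (fun t w => ∫⁻ x, g (e.symm t) (w, x) ∂(I.F (e.symm t) : Measure ℝ≥0))
    fun t => (hg _).lintegral_prod_right']
  rw [← Equiv.prod_comp e fun t => ∫⁻ w, ∫⁻ x, g (e.symm t) (w, x) ∂(I.F (e.symm t) : Measure ℝ≥0)]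
  refine Finset.prod_congr rfl fun j _ => ?_
  simp only [Equiv.symm_apply_apply]
  rw [lintegral_prod _ (hg j).aemeasurable]

/-- The lexicographic condition `(x, w) ≤ (θ, u)` under which a single threshold rule rejects the
value `x` when its random tie-breaker is `w`. -/
def Rejects (θ : ℝ≥0∞) (u : unitInterval) (z : unitInterval × ℝ≥0) : Prop :=
  (z.2 : ℝ≥0∞) < θ ∨ ((z.2 : ℝ≥0∞) = θ ∧ z.1 ≤ u)

theorem measurableSet_rejects (θ : ℝ≥0∞) (u : unitInterval) :
    MeasurableSet {z : unitInterval × ℝ≥0 | Rejects θ u z} := by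
  have h1 : Measurable fun z : unitInterval × ℝ≥0 => (z.2 : ℝ≥0∞) := by fun_prop
  have h2 : Measurable fun z : unitInterval × ℝ≥0 => z.1 := by fun_prop
  exact (measurableSet_lt h1 measurable_const).union
    ((measurableSet_eq_fun h1 measurable_const).inter (measurableSet_le (f := fun z : unitInterval × ℝ≥0 => z.1) h2 measurable_const))

open Classical in
/-- The indicator function of rejection. -/
noncomputable def rejectInd (θ : ℝ≥0∞) (u : unitInterval) (z : unitInterval × ℝ≥0) : ℝ≥0 :=
  if Rejects θ u z then 1 else 0

theorem measurable_rejectInd (θ : ℝ≥0∞) (u : unitInterval) : Measurable (rejectInd θ u) :=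
  Measurable.ite (measurableSet_rejects θ u) measurable_const measurable_const

theorem rejectInd_le_one (θ : ℝ≥0∞) (u : unitInterval) (z : unitInterval × ℝ≥0) :
    rejectInd θ u z ≤ 1 := by
  unfold rejectInd; split_ifs <;> simp

/-- The probability that item `j` is rejected. -/
noncomputable def rejectProb (I : ProphetInstance) (θ : ℝ≥0∞) (u : unitInterval) (j : Fin I.n) : ℝ≥0∞ :=
  ∫⁻ z, (rejectInd θ u z : ℝ≥0∞) ∂((volume : Measure unitInterval).prod (I.F j : Measure ℝ≥0))

theorem rejectProb_le_one (I : ProphetInstance) (θ : ℝ≥0∞) (u : unitInterval) (j : Fin I.n) :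
    I.rejectProb θ u j ≤ 1 := by
  calc I.rejectProb θ u j ≤ ∫⁻ z, 1 ∂((volume : Measure unitInterval).prod (I.F j : Measure ℝ≥0)) :=
        lintegral_mono fun z => ENNReal.coe_le_one_iff.2 (rejectInd_le_one θ u z)
    _ = 1 := by simp

/-- Items are rejected independently of each other. This turns the condition on `(θ, u)` into the
product of rejection probabilities that the bound on random orders needs. -/
theorem probMaxLETie_eq_prod (I : ProphetInstance) (θ : ℝ≥0∞) (u : unitInterval) :
    I.probMaxLETie θ u = ∏ j, I.rejectProb θ u j := by
  have hm : Measurable fun z : I.Seed × (Fin I.n → ℝ≥0) =>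
      ∏ j, (rejectInd θ u (z.1 j, z.2 j) : ℝ≥0∞) := by
    have := measurable_rejectInd θ u
    fun_prop
  have h := I.lintegral_seed_prod_law (Equiv.refl _) (fun _ z => (rejectInd θ u z : ℝ≥0∞))
    fun _ => (measurable_rejectInd θ u).coe_nnreal_ennreal
  simp only [Equiv.refl_apply] at h
  unfold rejectProb
  rw [← h, ← lintegral_prod_swap]
  have hS : MeasurableSet {q : (Fin I.n → ℝ≥0) × (Fin I.n → unitInterval) |
      ∀ i, (q.1 i : ℝ≥0∞) < θ ∨ ((q.1 i : ℝ≥0∞) = θ ∧ q.2 i ≤ u)} := by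
    rw [Set.ofPred_forall]
    refine MeasurableSet.iInter fun i => ?_
    have : Measurable fun q : (Fin I.n → ℝ≥0) × (Fin I.n → unitInterval) => (q.2 i, q.1 i) := by
      fun_prop
    exact this (measurableSet_rejects θ u)
  rw [probMaxLETie, ← lintegral_indicator_one hS]
  refine lintegral_congr fun q => ?_
  by_cases hq : ∀ i, (q.1 i : ℝ≥0∞) < θ ∨ ((q.1 i : ℝ≥0∞) = θ ∧ q.2 i ≤ u)
  · rw [Set.indicator_of_mem (by exact hq)]
    symm
    refine Finset.prod_eq_one fun j _ => ?_
    have : Rejects θ u (q.2 j, q.1 j) := hq j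
    simp [rejectInd, this]
  · rw [Set.indicator_of_notMem (by exact hq)]
    obtain ⟨j, hj⟩ := not_forall.1 hq
    symm
    refine Finset.prod_eq_zero (Finset.mem_univ j) ?_
    have : ¬ Rejects θ u (q.2 j, q.1 j) := hj
    simp [rejectInd, this]

theorem maxValue_le_iff (I : ProphetInstance) (x : Fin I.n → ℝ≥0) (θ : ℝ≥0∞) :
    (I.maxValue x : ℝ≥0∞) ≤ θ ↔ ∀ i, (x i : ℝ≥0∞) ≤ θ := by
  induction θ with
  | top => simp
  | coe θ => simp [maxValue]

theorem probMaxLETie_one (I : ProphetInstance) (θ : ℝ≥0∞) :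
    I.probMaxLETie θ 1 = I.probMaxLE θ := by
  have : {q : (Fin I.n → ℝ≥0) × (Fin I.n → unitInterval) |
      ∀ i, (q.1 i : ℝ≥0∞) < θ ∨ ((q.1 i : ℝ≥0∞) = θ ∧ q.2 i ≤ 1)} =
      {x | (I.maxValue x : ℝ≥0∞) ≤ θ} ×ˢ Set.univ := by
    ext q
    have h1 : ∀ i, q.2 i ≤ 1 := fun i => unitInterval.le_one'
    have h2 : ∀ i, ((q.1 i : ℝ≥0∞) < θ ∨ ((q.1 i : ℝ≥0∞) = θ ∧ q.2 i ≤ 1)) ↔ (q.1 i : ℝ≥0∞) ≤ θ :=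
      fun i => by rw [and_iff_left (h1 i), le_iff_lt_or_eq]
    rw [Set.mem_prod, and_iff_left (Set.mem_univ _)]
    exact (forall_congr' h2).trans (I.maxValue_le_iff q.1 θ).symm
  rw [probMaxLETie, this, Measure.prod_prod, measure_univ, mul_one, probMaxLE]

theorem exists_eq_maxValue (I : ProphetInstance) (x : Fin I.n → ℝ≥0) : ∃ i, I.maxValue x = x i := by
  obtain ⟨i, -, h⟩ := Finset.exists_mem_eq_sup Finset.univ ⟨⟨0, I.n_pos⟩, Finset.mem_univ _⟩ x
  exact ⟨i, h⟩

theorem le_maxValue (I : ProphetInstance) (x : Fin I.n → ℝ≥0) (i : Fin I.n) : x i ≤ I.maxValue x :=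
  Finset.le_sup (f := x) (Finset.mem_univ i)

theorem measurable_maxValue (I : ProphetInstance) : Measurable I.maxValue := by
  have h : (Finset.univ : Finset (Fin I.n)).Nonempty := ⟨⟨0, I.n_pos⟩, Finset.mem_univ _⟩
  have : I.maxValue = Finset.univ.sup' h fun i (x : Fin I.n → ℝ≥0) => x i := by
    ext x
    rw [Finset.sup'_apply, Finset.sup'_eq_sup, maxValue]
  rw [this]
  exact Finset.measurable_sup' h fun i _ => measurable_pi_apply i

theorem opt_ne_top (I : ProphetInstance) : I.opt ≠ ⊤ := by
  have : I.opt ≤ ∑ i, ∫⁻ x, (x : ℝ≥0∞) ∂(I.F i : Measure ℝ≥0) := by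
    calc I.opt ≤ ∫⁻ x, ∑ i, (x i : ℝ≥0∞) ∂I.law := by
          refine lintegral_mono fun x => ?_
          obtain ⟨i, hi⟩ := I.exists_eq_maxValue x
          rw [hi]
          exact Finset.single_le_sum (f := fun i => (x i : ℝ≥0∞)) (fun _ _ => zero_le)
            (Finset.mem_univ i)
      _ = _ := by
          rw [lintegral_finsetSum _ fun i _ => by fun_prop]
          exact Finset.sum_congr rfl fun i _ =>
            I.lintegral_law_eval i (f := fun x => (x : ℝ≥0∞)) (by fun_prop)
  exact ne_top_of_le_ne_top (ENNReal.sum_ne_top.2 fun i _ => I.finite_mean i) this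

theorem gamma_mul_maxValue_le_payoff_top (I : ProphetInstance) (γ : ℝ≥0) (π : Equiv.Perm (Fin I.n))
    (x : Fin I.n → ℝ≥0) : γ * I.maxValue x ≤ I.payoff γ π x ⊤ := by
  obtain ⟨i, hi⟩ := I.exists_eq_maxValue x
  refine le_trans ?_ (Finset.le_sup (Finset.mem_univ (π.symm i)))
  simp [hi]

theorem le_payoff_coe (I : ProphetInstance) (γ : ℝ≥0) (π : Equiv.Perm (Fin I.n))
    (x : Fin I.n → ℝ≥0) (τ : Fin I.n) : x (π τ) ≤ I.payoff γ π x τ := by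
  refine le_trans ?_ (Finset.le_sup (Finset.mem_univ τ))
  simp

end ProphetInstance

/-! ### The guarantee of single-threshold algorithms. -/

open ProphetInstance

theorem singleThreshold_accept_iff (θ : ProphetInstance → ℝ≥0∞) (u : ProphetInstance → unitInterval)
    (I : ProphetInstance) (ω : I.Seed) (π : Equiv.Perm (Fin I.n)) (x : Fin I.n → ℝ≥0)
    (t : Fin I.n) :
    (singleThreshold θ u).accept I t ω (I.history π x t) = true ↔
      ¬ Rejects (θ I) (u I) (ω t, x (π t)) := by
  have : (singleThreshold θ u).accept I t ω (I.history π x t) =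
    decide (θ I < (x (π t) : ℝ≥0∞) ∨ ((x (π t) : ℝ≥0∞) = θ I ∧ u I < ω t)) := rfl
  rw [this, decide_eq_true_iff, Rejects, not_or, not_and, not_lt, not_le]
  constructor
  · rintro (h | h)
    · exact ⟨h.le, fun h' => absurd h' h.ne'⟩
    · exact ⟨h.1.ge, fun _ => h.2⟩
  · rintro ⟨h, h'⟩
    exact h.lt_or_eq.imp_right fun h => ⟨h.symm, h' h.symm⟩

open Classical in
theorem singleThreshold_stoppingTime (θ : ProphetInstance → ℝ≥0∞)
    (u : ProphetInstance → unitInterval) (I : ProphetInstance) (ω : I.Seed)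
    (π : Equiv.Perm (Fin I.n)) (x : Fin I.n → ℝ≥0) :
    (singleThreshold θ u).stoppingTime I ω π x =
      (Finset.univ.filter fun t => ¬ Rejects (θ I) (u I) (ω t, x (π t))).min :=
  congrArg Finset.min <| Finset.filter_congr fun t _ =>
    singleThreshold_accept_iff θ u I ω π x t

open Classical in
/-- The pointwise inequality behind the guarantee of single threshold algorithms. -/
theorem singleThreshold_pointwise {γ b r p : ℝ≥0} (hb : b + γ = 1) (hr : r + b * p = 1)
    (hp : p ≤ 1) (Θ : ProphetInstance → ℝ≥0∞) (u : ProphetInstance → unitInterval)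
    (I : ProphetInstance) {θ : ℝ≥0} (hθ : Θ I = θ) (ω : I.Seed) (π : Equiv.Perm (Fin I.n))
    (x : Fin I.n → ℝ≥0) :
    r * I.maxValue x + b * p * θ + ∑ i, (x i - θ) *
        ∏ j, (if π.symm j < π.symm i then rejectInd θ (u I) (ω (π.symm j), x j) else 1) ≤
      I.payoff γ π x ((singleThreshold Θ u).stoppingTime I ω π x) +
        b * θ * ∏ j, rejectInd θ (u I) (ω (π.symm j), x j) + r * ∑ i, (x i - θ) := by
  have hrej : ∀ i w, Rejects θ (u I) (w, x i) → x i ≤ θ := by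
    rintro i w (h | h)
    · exact_mod_cast h.le
    · exact_mod_cast h.1.le
  have hacc : ∀ i w, ¬ Rejects θ (u I) (w, x i) → θ ≤ x i := by
    intro i w h
    by_contra h'
    exact h (Or.inl (by exact_mod_cast not_le.1 h'))
  have hbR : (b : ℝ) + γ = 1 := by exact_mod_cast hb
  have hrR : (r : ℝ) + b * p = 1 := by exact_mod_cast hr
  have hpR : (p : ℝ) ≤ 1 := by exact_mod_cast hp
  obtain ⟨iM, hM⟩ := I.exists_eq_maxValue x
  rw [singleThreshold_stoppingTime, hθ]
  set S := Finset.univ.filter fun t => ¬ Rejects θ (u I) (ω t, x (π t)) with hS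
  rcases hτ : S.min with _ | τ
  · have hemp : S = ∅ := Finset.min_eq_top.1 hτ
    have hall : ∀ j, Rejects θ (u I) (ω (π.symm j), x j) := by
      intro j
      by_contra h
      have : π.symm j ∈ S := by simp [hS, h]
      simp [hemp] at this
    have hz : ∀ i, x i - θ = 0 := fun i => tsub_eq_zero_of_le (hrej i _ (hall i))
    have hN : ∏ j, rejectInd θ (u I) (ω (π.symm j), x j) = 1 :=
      Finset.prod_eq_one fun j _ => by simp [rejectInd, hall j]
    have hpay := I.gamma_mul_maxValue_le_payoff_top γ π x
    have hMθ : I.maxValue x ≤ θ := hM ▸ hrej iM _ (hall iM)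
    change _ ≤ I.payoff γ π x ⊤ + _ + _
    simp only [hz, hN, zero_mul, Finset.sum_const_zero, add_zero, mul_zero, mul_one]
    refine le_trans ?_ (add_le_add_left hpay _)
    rw [← NNReal.coe_le_coe] at hMθ ⊢
    push_cast
    -- Since `r - γ = b * (1 - p)`, the claim is `b * (1 - p)` times the inequality `max ≤ θ`.
    have h1 : (0 : ℝ) ≤ b * (1 - p) := mul_nonneg b.2 (by linarith)
    have hg : (γ : ℝ) = 1 - b := by linarith
    have hr' : (r : ℝ) = 1 - b * p := by linarith
    rw [hg, hr']
    nlinarith [mul_nonneg h1 (sub_nonneg.2 hMθ)]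
  · change S.min = (τ : WithTop (Fin I.n)) at hτ
    change _ ≤ I.payoff γ π x (τ : WithTop (Fin I.n)) + _ + _
    have hmem : ¬ Rejects θ (u I) (ω τ, x (π τ)) := by
      have := Finset.mem_of_min hτ
      simpa [hS] using this
    have hbef : ∀ s, s < τ → Rejects θ (u I) (ω s, x (π s)) := by
      intro s hs
      by_contra h
      have : s ∈ S := by simp [hS, h]
      exact absurd (Finset.min_le_of_eq this hτ) (not_le.2 hs)
    have hpay := I.le_payoff_coe γ π x τ
    have hge := hacc _ _ hmem
    have hsum : ∑ i, (x i - θ) *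
        ∏ j, (if π.symm j < π.symm i then rejectInd θ (u I) (ω (π.symm j), x j) else 1) ≤
        x (π τ) - θ := by
      -- Only the accepted item contributes: items before it are rejected and have no excess over
      -- `θ`, while for items after it the product contains the vanishing factor of the accepted
      -- item.
      rw [Finset.sum_eq_single (π τ)]
      · refine mul_le_of_le_one_right zero_le (Finset.prod_le_one' fun j _ => ?_)
        split_ifs
        · exact rejectInd_le_one _ _ _
        · exact le_rfl
      · intro i _ hi
        have hne : π.symm i ≠ τ := fun h => hi (by rw [← h]; simp)
        rcases lt_or_gt_of_ne hne with h | h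
        · have := hrej i (ω (π.symm i)) (by simpa using hbef _ h)
          rw [tsub_eq_zero_of_le this, zero_mul]
        · rw [Finset.prod_eq_zero (Finset.mem_univ (π τ)), mul_zero]
          simp [h, rejectInd, hmem]
      · simp
    have hMle : I.maxValue x ≤ θ + ∑ i, (x i - θ) := by
      rw [hM]
      exact le_add_tsub.trans (add_le_add_right (Finset.single_le_sum
        (f := fun i => x i - θ) (fun _ _ => zero_le) (Finset.mem_univ iM)) _)
    calc _ ≤ r * (θ + ∑ i, (x i - θ)) + b * p * θ + (x (π τ) - θ) := by gcongr
      _ = (r + b * p) * θ + (x (π τ) - θ) + r * ∑ i, (x i - θ) := by ring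
      _ = x (π τ) + r * ∑ i, (x i - θ) := by rw [hr, one_mul, add_tsub_cancel_of_le hge]
      _ ≤ _ := by
        gcongr
        exact hpay.trans le_self_add


/-- The expected excess of item `i` over `θ`, restricted to the event that in the order `π` no item
is accepted before item `i`. -/
theorem lintegral_excess_mul_prod (I : ProphetInstance) (θ : ℝ≥0) (u : unitInterval)
    (π : Equiv.Perm (Fin I.n)) (i : Fin I.n) :
    ∫⁻ z : I.Seed × (Fin I.n → ℝ≥0), (((z.2 i - θ) *
        ∏ j, (if π.symm j < π.symm i then rejectInd θ u (z.1 (π.symm j), z.2 j) else 1) : ℝ≥0) :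
          ℝ≥0∞) ∂((volume : Measure I.Seed).prod I.law) =
      (∫⁻ x, ((x - θ : ℝ≥0) : ℝ≥0∞) ∂(I.F i : Measure ℝ≥0)) *
        ∏ j, (if π.symm j < π.symm i then I.rejectProb θ u j else 1) := by
  have hR := measurable_rejectInd θ u
  -- Item `i` does not precede itself, so its slot in the product is free to hold the excess.
  set g : Fin I.n → unitInterval × ℝ≥0 → ℝ≥0∞ := fun j w =>
    if j = i then ((w.2 - θ : ℝ≥0) : ℝ≥0∞)
    else if π.symm j < π.symm i then (rejectInd θ u w : ℝ≥0∞) else 1 with hg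
  have hgm : ∀ j, Measurable (g j) := by
    intro j
    simp only [hg]
    split_ifs <;> fun_prop
  have key := I.lintegral_seed_prod_law π.symm g hgm
  have e1 : ∀ z : I.Seed × (Fin I.n → ℝ≥0), ∏ j, g j (z.1 (π.symm j), z.2 j) = (((z.2 i - θ) *
        ∏ j, (if π.symm j < π.symm i then rejectInd θ u (z.1 (π.symm j), z.2 j) else 1) : ℝ≥0) :
          ℝ≥0∞) := by
    intro z
    rw [← Finset.mul_prod_erase _ _ (Finset.mem_univ i),
      ← Finset.mul_prod_erase (a := i) Finset.univ
        (fun j => if π.symm j < π.symm i then rejectInd θ u (z.1 (π.symm j), z.2 j) else 1)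
        (Finset.mem_univ i)]
    simp only [lt_irrefl, if_false, one_mul]
    push_cast
    congr 1
    · simp [hg]
    · refine Finset.prod_congr rfl fun j hj => ?_
      simp only [hg, Finset.ne_of_mem_erase hj, if_false]
      split_ifs <;> simp
  simp only [e1] at key
  rw [key, ← Finset.mul_prod_erase _ _ (Finset.mem_univ i),
      ← Finset.mul_prod_erase (a := i) Finset.univ
        (fun j => if π.symm j < π.symm i then I.rejectProb θ u j else 1) (Finset.mem_univ i)]
  simp only [lt_irrefl, if_false, one_mul]
  congr 1
  · simp only [hg, if_true]
    rw [lintegral_prod _ (by fun_prop)]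
    simp
  · refine Finset.prod_congr rfl fun j hj => ?_
    simp only [hg, Finset.ne_of_mem_erase hj, if_false]
    split_ifs
    · rfl
    · simp

theorem lintegral_excess_ne_top (I : ProphetInstance) (θ : ℝ≥0) (i : Fin I.n) :
    ∫⁻ x, ((x - θ : ℝ≥0) : ℝ≥0∞) ∂(I.F i : Measure ℝ≥0) ≠ ⊤ :=
  ne_top_of_le_ne_top (I.finite_mean i) <| lintegral_mono fun _ =>
    ENNReal.coe_le_coe.2 tsub_le_self

/-- On average over the order, the chance that nothing is accepted before item `i` is at least
`ratioLog p`, where `p` is the probability that nothing is accepted at all. -/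
theorem ratioLog_le_sum_perm_rejectProb (I : ProphetInstance) (θ : ℝ≥0∞) (u : unitInterval)
    {p : ℝ} (hp0 : 0 < p) (h : I.probMaxLETie θ u = ENNReal.ofReal p) (i : Fin I.n) :
    ENNReal.ofReal (ratioLog p) * I.n.factorial ≤
      ∑ π : Equiv.Perm (Fin I.n), ∏ j,
        (if π.symm j < π.symm i then I.rejectProb θ u j else 1) := by
  have hprod : ∏ j, I.rejectProb θ u j = ENNReal.ofReal p := by rw [← probMaxLETie_eq_prod, h]
  have hne : ∀ j, I.rejectProb θ u j ≠ ⊤ := fun j =>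
    ne_top_of_le_ne_top ENNReal.one_ne_top (I.rejectProb_le_one θ u j)
  have h0 : ∀ j, 0 < (I.rejectProb θ u j).toReal := by
    refine fun j => ENNReal.toReal_pos (fun hz => ?_) (hne j)
    rw [Finset.prod_eq_zero (Finset.mem_univ j) hz] at hprod
    exact (ENNReal.ofReal_pos.2 hp0).ne hprod
  have h1 : ∀ j, (I.rejectProb θ u j).toReal ≤ 1 := fun j =>
    ENNReal.toReal_le_of_le_ofReal zero_le_one (by simpa using I.rejectProb_le_one θ u j)
  have hpr : ∏ j, (I.rejectProb θ u j).toReal = p := by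
    rw [← ENNReal.toReal_prod, hprod, ENNReal.toReal_ofReal hp0.le]
  have key := ratioLog_prod_le_sum_perm i (fun j => (I.rejectProb θ u j).toReal) h0 h1
  rw [hpr] at key
  have := ENNReal.ofReal_le_ofReal key
  rw [ENNReal.ofReal_mul' (Nat.cast_nonneg _), ENNReal.ofReal_natCast] at this
  refine this.trans_eq ?_
  rw [ENNReal.ofReal_sum_of_nonneg fun π _ => Finset.prod_nonneg fun j _ => by
    split_ifs <;> simp]
  refine Finset.sum_congr rfl fun π _ => ?_
  rw [ENNReal.ofReal_prod_of_nonneg fun j _ => by split_ifs <;> simp]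
  refine Finset.prod_congr rfl fun j _ => ?_
  split_ifs
  · exact ENNReal.ofReal_toReal (hne j)
  · simp

/-- The expected reward dominates the iterated integral, taken over the product space. -/
theorem lintegral_sum_payoff_le (A : Algorithm) (γ : ℝ≥0) (I : ProphetInstance) :
    ∫⁻ z, (∑ π : Equiv.Perm (Fin I.n), (I.payoff γ π z.2 (A.stoppingTime I z.1 π z.2) : ℝ≥0∞))
      ∂((volume : Measure I.Seed).prod I.law) ≤ A.expectedReward γ I * I.n.factorial := by
  have h0 : (I.n.factorial : ℝ≥0∞) ≠ 0 := by exact_mod_cast I.n.factorial_ne_zero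
  have ht : (I.n.factorial : ℝ≥0∞) ≠ ⊤ := ENNReal.natCast_ne_top _
  rw [← ENNReal.div_le_iff h0 ht, div_eq_mul_inv,
    ← lintegral_mul_const' _ _ (ENNReal.inv_ne_top.2 h0)]
  -- This direction of Tonelli holds for every function, so the reward of `A` need not be shown
  -- measurable.
  exact lintegral_prod_le _

/-- The pointwise inequality is integrated and summed over the orders. The term `b * p * θ` then
appears on both sides, because `p` is the probability of no acceptance. The excess terms on the left
dominate those on the right by the bound on random orders and `ratioLog p = r`. It is stated without
subtraction, so the common terms only have to be finite to cancel. -/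
theorem singleThreshold_coe_mul_opt_le {γ b r p : ℝ≥0} (hb : b + γ = 1) (hr : r + b * p = 1)
    (hp0 : 0 < p) (hp : p ≤ 1) (hratio : ratioLog p = r) (Θ : ProphetInstance → ℝ≥0∞)
    (u : ProphetInstance → unitInterval) (I : ProphetInstance) {θ : ℝ≥0} (hθ : Θ I = θ)
    (h : I.probMaxLETie θ (u I) = p) :
    r * I.opt ≤ (singleThreshold Θ u).expectedReward γ I := by
  have h' : I.probMaxLETie θ (u I) = ENNReal.ofReal p := by rw [h, ENNReal.ofReal_coe_nnreal]
  set μ := (volume : Measure I.Seed).prod I.law with hμ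
  have hR := measurable_rejectInd θ (u I)
  have hM := I.measurable_maxValue
  set f : ℝ≥0∞ := (I.n.factorial : ℝ≥0∞) with hf
  have hf0 : f ≠ 0 := by rw [hf]; exact_mod_cast I.n.factorial_ne_zero
  have hft : f ≠ ⊤ := ENNReal.natCast_ne_top _
  set e : Fin I.n → ℝ≥0∞ := fun i => ∫⁻ x, ((x - θ : ℝ≥0) : ℝ≥0∞) ∂(I.F i : Measure ℝ≥0) with he
  have het : ∀ i, e i ≠ ⊤ := lintegral_excess_ne_top I θ
  have hEz : ∑ i, e i ≠ ⊤ := ENNReal.sum_ne_top.2 fun i _ => het i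
  have hex : ∫⁻ z, ((∑ i, (z.2 i - θ) : ℝ≥0) : ℝ≥0∞) ∂μ = ∑ i, e i := by
    push_cast
    rw [lintegral_finsetSum _ fun i _ => by fun_prop]
    refine Finset.sum_congr rfl fun i _ => ?_
    rw [hμ, lintegral_prod _ (by fun_prop)]
    simp only [lintegral_const, measure_univ, mul_one]
    exact I.lintegral_law_eval i (f := fun x => ((x - θ : ℝ≥0) : ℝ≥0∞)) (by fun_prop)
  have hopt : ∫⁻ z, (I.maxValue z.2 : ℝ≥0∞) ∂μ = I.opt := by
    rw [hμ, lintegral_prod _ (by fun_prop)]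
    simp [opt]
  have hnone : ∀ π : Equiv.Perm (Fin I.n),
      ∫⁻ z, ((∏ j, rejectInd θ (u I) (z.1 (π.symm j), z.2 j) : ℝ≥0) : ℝ≥0∞) ∂μ = p := by
    intro π
    have := I.lintegral_seed_prod_law π.symm (fun _ z => (rejectInd θ (u I) z : ℝ≥0∞))
      fun _ => hR.coe_nnreal_ennreal
    push_cast
    rw [hμ, this, ← h, probMaxLETie_eq_prod]
    rfl
  have hsum : (r : ℝ≥0∞) * f * ∑ i, e i ≤ ∑ π : Equiv.Perm (Fin I.n), ∑ i,
      ∫⁻ z : I.Seed × (Fin I.n → ℝ≥0), (((z.2 i - θ) *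
        ∏ j, (if π.symm j < π.symm i then rejectInd θ (u I) (z.1 (π.symm j), z.2 j) else 1) :
          ℝ≥0) : ℝ≥0∞) ∂μ := by
    rw [Finset.sum_comm, Finset.mul_sum]
    refine Finset.sum_le_sum fun i _ => ?_
    simp only [hμ, lintegral_excess_mul_prod]
    rw [← Finset.mul_sum, mul_comm]
    refine mul_le_mul_right ?_ _
    have := ratioLog_le_sum_perm_rejectProb I θ (u I) (p := p) (by exact_mod_cast hp0) h' i
    rwa [hratio, ENNReal.ofReal_coe_nnreal] at this
  have hpt : ∀ z : I.Seed × (Fin I.n → ℝ≥0), ∀ π : Equiv.Perm (Fin I.n),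
      ((r * I.maxValue z.2 + b * p * θ + ∑ i, (z.2 i - θ) *
        ∏ j, (if π.symm j < π.symm i then rejectInd θ (u I) (z.1 (π.symm j), z.2 j) else 1) :
          ℝ≥0) : ℝ≥0∞) ≤
      (I.payoff γ π z.2 ((singleThreshold Θ u).stoppingTime I z.1 π z.2) : ℝ≥0∞) +
        ((b * θ * ∏ j, rejectInd θ (u I) (z.1 (π.symm j), z.2 j) + r * ∑ i, (z.2 i - θ) : ℝ≥0) :
          ℝ≥0∞) := fun z π => by
    have := singleThreshold_pointwise hb hr hp Θ u I hθ z.1 π z.2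
    rwa [← ENNReal.coe_add, ENNReal.coe_le_coe, ← add_assoc]
  have hleft : ∀ π : Equiv.Perm (Fin I.n), ∫⁻ z, ((r * I.maxValue z.2 + b * p * θ +
      ∑ i, (z.2 i - θ) * ∏ j, (if π.symm j < π.symm i then
        rejectInd θ (u I) (z.1 (π.symm j), z.2 j) else 1) : ℝ≥0) : ℝ≥0∞) ∂μ =
      r * I.opt + b * p * θ + ∑ i, ∫⁻ z : I.Seed × (Fin I.n → ℝ≥0), (((z.2 i - θ) *
        ∏ j, (if π.symm j < π.symm i then rejectInd θ (u I) (z.1 (π.symm j), z.2 j) else 1) :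
          ℝ≥0) : ℝ≥0∞) ∂μ := by
    intro π
    have hm : ∀ i, Measurable fun z : I.Seed × (Fin I.n → ℝ≥0) => ((z.2 i - θ) *
        ∏ j, (if π.symm j < π.symm i then rejectInd θ (u I) (z.1 (π.symm j), z.2 j) else 1)) := by
      refine fun i => Measurable.mul (by fun_prop) (Finset.measurable_prod _ fun j _ => ?_)
      split_ifs <;> fun_prop
    simp only [ENNReal.coe_add, ENNReal.ofNNReal_finsetSum, ENNReal.coe_mul r]
    rw [lintegral_add_left (by fun_prop), lintegral_add_left (by fun_prop),
      lintegral_const_mul _ (by fun_prop), hopt,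
      lintegral_finsetSum _ fun i _ => (hm i).coe_nnreal_ennreal]
    simp
  have hright : ∀ π : Equiv.Perm (Fin I.n), ∫⁻ z, ((b * θ *
      ∏ j, rejectInd θ (u I) (z.1 (π.symm j), z.2 j) + r * ∑ i, (z.2 i - θ) : ℝ≥0) : ℝ≥0∞) ∂μ =
      b * p * θ + r * ∑ i, e i := by
    intro π
    simp only [ENNReal.coe_add, ENNReal.coe_mul]
    rw [lintegral_add_left (by fun_prop), lintegral_const_mul _ (by fun_prop), hnone,
      lintegral_const_mul _ (by fun_prop), hex]
    ring
  have hint : ∑ π : Equiv.Perm (Fin I.n), ∫⁻ z, ((r * I.maxValue z.2 + b * p * θ +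
      ∑ i, (z.2 i - θ) * ∏ j, (if π.symm j < π.symm i then
        rejectInd θ (u I) (z.1 (π.symm j), z.2 j) else 1) : ℝ≥0) : ℝ≥0∞) ∂μ ≤
      (∫⁻ z, ∑ π : Equiv.Perm (Fin I.n),
        (I.payoff γ π z.2 ((singleThreshold Θ u).stoppingTime I z.1 π z.2) : ℝ≥0∞) ∂μ) +
      ∑ π : Equiv.Perm (Fin I.n), ∫⁻ z, ((b * θ *
      ∏ j, rejectInd θ (u I) (z.1 (π.symm j), z.2 j) + r * ∑ i, (z.2 i - θ) : ℝ≥0) : ℝ≥0∞) ∂μ := by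
    have hmR : ∀ π : Equiv.Perm (Fin I.n), Measurable fun z : I.Seed × (Fin I.n → ℝ≥0) =>
      ((b * θ * ∏ j, rejectInd θ (u I) (z.1 (π.symm j), z.2 j) + r * ∑ i, (z.2 i - θ) : ℝ≥0) :
        ℝ≥0∞) := fun π => by fun_prop
    have hmL : ∀ π : Equiv.Perm (Fin I.n), Measurable fun z : I.Seed × (Fin I.n → ℝ≥0) =>
      ((r * I.maxValue z.2 + b * p * θ +
      ∑ i, (z.2 i - θ) * ∏ j, (if π.symm j < π.symm i then
        rejectInd θ (u I) (z.1 (π.symm j), z.2 j) else 1) : ℝ≥0) : ℝ≥0∞) := by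
      refine fun π => (Measurable.add (by fun_prop) (Finset.measurable_sum _ fun i _ =>
        Measurable.mul (by fun_prop)
          (Finset.measurable_prod _ fun j _ => ?_))).coe_nnreal_ennreal
      split_ifs <;> fun_prop
    rw [← lintegral_finsetSum _ fun π _ => hmL π, ← lintegral_finsetSum _ fun π _ => hmR π,
      ← lintegral_add_right _ (Finset.measurable_sum _ fun π _ => hmR π)]
    refine lintegral_mono fun z => ?_
    rw [← Finset.sum_add_distrib]
    exact Finset.sum_le_sum fun π _ => hpt z π
  simp only [hleft, hright, Finset.sum_add_distrib, Finset.sum_const, Finset.card_univ,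
    Fintype.card_perm, Fintype.card_fin, nsmul_eq_mul, ← hf] at hint
  have hrew := lintegral_sum_payoff_le (singleThreshold Θ u) γ I
  rw [← hμ, ← hf] at hrew
  set R := (singleThreshold Θ u).expectedReward γ I
  have h1 : r * I.opt * f + (f * (b * p * θ) + f * (r * ∑ i, e i)) ≤
      R * f + (f * (b * p * θ) + f * (r * ∑ i, e i)) := by
    calc r * I.opt * f + (f * (b * p * θ) + f * (r * ∑ i, e i))
        = f * (r * I.opt) + f * (b * p * θ) + r * f * ∑ i, e i := by ring
      _ ≤ _ := add_le_add_right hsum _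
      _ ≤ _ := hint
      _ ≤ _ := add_le_add_left hrew _
  have hfin : f * (b * p * θ) + f * (r * ∑ i, e i) ≠ ⊤ := by
    refine ENNReal.add_ne_top.2 ⟨ENNReal.mul_ne_top hft ?_,
      ENNReal.mul_ne_top hft (ENNReal.mul_ne_top ENNReal.coe_ne_top hEz)⟩
    exact ENNReal.mul_ne_top (ENNReal.mul_ne_top ENNReal.coe_ne_top ENNReal.coe_ne_top)
      ENNReal.coe_ne_top
  exact (ENNReal.mul_le_mul_iff_left hf0 hft).1 ((ENNReal.add_le_add_iff_right hfin).1 h1)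

theorem singleThreshold_mul_opt_le {γ : ℝ≥0} (hγ : γ ≤ 1) {p : ℝ} (hp : IsPGamma γ p)
    (Θ : ProphetInstance → ℝ≥0∞) (u : ProphetInstance → unitInterval) (I : ProphetInstance)
    (h : I.probMaxLETie (Θ I) (u I) = ENNReal.ofReal p) :
    ENNReal.ofReal (1 - (1 - (γ : ℝ)) * p) * I.opt ≤
      (singleThreshold Θ u).expectedReward γ I := by
  obtain ⟨hp0, hp1, hpe⟩ := hp
  have hγ' : (γ : ℝ) ≤ 1 := by exact_mod_cast hγ
  cases hθ : Θ I with
  | coe θ =>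
    rw [hθ] at h
    lift p to ℝ≥0 using hp0.le
    have hbp : (1 - (γ : ℝ)) * p ≤ 1 := by nlinarith [γ.2]
    obtain ⟨r, hr⟩ : ∃ r : ℝ≥0, (r : ℝ) = 1 - (1 - (γ : ℝ)) * p := ⟨⟨_, by linarith⟩, rfl⟩
    rw [← hr, ENNReal.ofReal_coe_nnreal]
    refine singleThreshold_coe_mul_opt_le (γ := γ) (b := 1 - γ) (p := p)
      (tsub_add_cancel_of_le hγ) ?_ (by exact_mod_cast hp0) (by exact_mod_cast hp1)
      (hpe.symm.trans hr.symm) Θ u I hθ (by rw [h, ENNReal.ofReal_coe_nnreal])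
    rw [← NNReal.coe_inj]
    push_cast [NNReal.coe_sub hγ]
    rw [hr]
    ring
  -- The threshold `⊤` rejects everything, which forces `p = 1` and then `γ = 1`; never stopping now
  -- earns the whole maximum.
  | top =>
    have hp' : p = 1 := by
      rw [hθ] at h
      have hu : I.probMaxLETie ⊤ (u I) = 1 := by
        simp [probMaxLETie]
      rw [hu, eq_comm, ENNReal.ofReal_eq_one] at h
      exact h
    subst hp'
    rw [ratioLog_one] at hpe
    have hγ1 : γ = 1 := by
      rw [← NNReal.coe_inj]; push_cast; linarith
    subst hγ1
    have hf0 : (I.n.factorial : ℝ≥0∞) ≠ 0 := by exact_mod_cast I.n.factorial_ne_zero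
    have hlow := lintegral_sum_payoff_le (singleThreshold Θ u) 1 I
    have hst : ∀ ω π x, (singleThreshold Θ u).stoppingTime I ω π x = ⊤ := by
      intro ω π x
      classical
      rw [singleThreshold_stoppingTime, hθ, Finset.min_eq_top, Finset.filter_eq_empty_iff]
      exact fun t _ h => h (Or.inl ENNReal.coe_lt_top)
    have hM := I.measurable_maxValue
    have h2 : I.opt * I.n.factorial ≤ (singleThreshold Θ u).expectedReward 1 I * I.n.factorial := by
      refine le_trans ?_ hlow
      rw [opt, ← lintegral_mul_const _ (by fun_prop)]
      have : ∫⁻ z : I.Seed × (Fin I.n → ℝ≥0), (I.maxValue z.2 : ℝ≥0∞) * I.n.factorial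
          ∂((volume : Measure I.Seed).prod I.law) =
          ∫⁻ x, (I.maxValue x : ℝ≥0∞) * I.n.factorial ∂I.law := by
        rw [lintegral_prod _ (by fun_prop)]
        simp
      rw [← this]
      refine lintegral_mono fun z => ?_
      simp only [hst]
      calc (I.maxValue z.2 : ℝ≥0∞) * I.n.factorial
          = ∑ π : Equiv.Perm (Fin I.n), (I.maxValue z.2 : ℝ≥0∞) := by
            simp [Fintype.card_perm, mul_comm]
        _ ≤ _ := Finset.sum_le_sum fun π _ => by
            have := I.gamma_mul_maxValue_le_payoff_top 1 π z.2
            rw [one_mul] at this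
            exact_mod_cast this
    have h3 := (ENNReal.mul_le_mul_iff_left hf0 (ENNReal.natCast_ne_top _)).1 h2
    simpa using h3

theorem le_competitiveRatio_singleThreshold {γ : ℝ≥0} (hγ : γ ≤ 1) {p : ℝ} (hp : IsPGamma γ p)
    (Θ : ProphetInstance → ℝ≥0∞) (u : ProphetInstance → unitInterval)
    (h : ∀ I : ProphetInstance, I.probMaxLETie (Θ I) (u I) = ENNReal.ofReal p) :
    ENNReal.ofReal (1 - (1 - (γ : ℝ)) * p) ≤ (singleThreshold Θ u).competitiveRatio γ := by
  refine le_iInf₂ fun I hI => ?_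
  rw [ENNReal.le_div_iff_mul_le (Or.inl hI) (Or.inl I.opt_ne_top)]
  exact singleThreshold_mul_opt_le hγ hp Θ u I (h I)

/-! ### Existence of thresholds. -/

open ProphetInstance Set Filter

/-- Existence of quantiles. -/
theorem exists_quantile (μ : Measure ℝ≥0∞) [IsProbabilityMeasure μ] {p : ℝ≥0∞} (hp : p ≤ 1) :
    ∃ θ, μ (Iio θ) ≤ p ∧ p ≤ μ (Iic θ) := by
  set S := {t | p ≤ μ (Iic t)} with hS
  have hne : S.Nonempty := ⟨⊤, by simpa [hS] using hp⟩
  -- Continuity of `μ` along increasing unions gives the first bound, along decreasing intersections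
  -- the second.
  refine ⟨sInf S, ?_, ?_⟩
  · rcases eq_or_ne (sInf S) 0 with h | h
    · simp [h]
    obtain ⟨v, hv, hvlt, hvt⟩ := exists_seq_strictMono_tendsto' (pos_iff_ne_zero.2 h)
    have hU : Iio (sInf S) = ⋃ n, Iic (v n) := by
      ext t
      simp only [mem_Iio, mem_iUnion, mem_Iic]
      exact ⟨fun ht => (((tendsto_order.1 hvt).1 _ ht).exists).imp fun _ => le_of_lt,
        fun ⟨n, hn⟩ => hn.trans_lt (hvlt n).2⟩
    rw [hU, Monotone.measure_iUnion fun m n hmn => Iic_subset_Iic.2 (hv.monotone hmn)]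
    refine iSup_le fun n => ?_
    by_contra hlt
    exact absurd (sInf_le (show v n ∈ S from (not_le.1 hlt).le)) (not_le.2 (hvlt n).2)
  · obtain ⟨v, hv, hvt, hvS⟩ := exists_seq_tendsto_sInf hne (OrderBot.bddBelow S)
    have hI : Iic (sInf S) = ⋂ n, Iic (v n) := by
      ext t
      simp only [mem_iInter, mem_Iic]
      exact ⟨fun ht n => ht.trans (sInf_le (hvS n)), fun ht => ge_of_tendsto' hvt ht⟩
    rw [hI]
    have := tendsto_measure_iInter_atTop (μ := μ) (s := fun n => Iic (v n))
      (fun n => measurableSet_Iic.nullMeasurableSet) (fun m n hmn => Iic_subset_Iic.2 (hv hmn))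
      ⟨0, measure_ne_top _ _⟩
    exact ge_of_tendsto' this hvS

theorem rejectProb_eq (I : ProphetInstance) (θ : ℝ≥0∞) (u : unitInterval) (j : Fin I.n) :
    I.rejectProb θ u j = (I.F j : Measure ℝ≥0) {x | (x : ℝ≥0∞) < θ} +
      ENNReal.ofReal u * (I.F j : Measure ℝ≥0) {x | (x : ℝ≥0∞) = θ} := by
  have h1 : MeasurableSet {x : ℝ≥0 | (x : ℝ≥0∞) < θ} := measurableSet_lt (by fun_prop) (by fun_prop)
  have h2 : MeasurableSet {x : ℝ≥0 | (x : ℝ≥0∞) = θ} :=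
    measurableSet_eq_fun (by fun_prop) (by fun_prop)
  have hset : {z : unitInterval × ℝ≥0 | Rejects θ u z} =
      univ ×ˢ {x : ℝ≥0 | (x : ℝ≥0∞) < θ} ∪ Iic u ×ˢ {x : ℝ≥0 | (x : ℝ≥0∞) = θ} := by
    ext z
    simp only [Rejects, mem_ofPred_eq, mem_union, mem_prod, mem_univ, true_and, mem_Iic]
    rw [and_comm (a := z.1 ≤ u)]
  have hdisj : Disjoint (univ ×ˢ {x : ℝ≥0 | (x : ℝ≥0∞) < θ})
      (Iic u ×ˢ {x : ℝ≥0 | (x : ℝ≥0∞) = θ}) := by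
    rw [Set.disjoint_left]
    rintro z ⟨-, h⟩ ⟨-, h'⟩
    exact h.ne h'
  have hind : ∀ z, (rejectInd θ u z : ℝ≥0∞) = {z | Rejects θ u z}.indicator 1 z := by
    intro z
    by_cases hz : Rejects θ u z <;> simp [rejectInd, hz]
  unfold rejectProb
  simp only [hind]
  rw [lintegral_indicator_one (measurableSet_rejects θ u), hset,
    measure_union hdisj (measurableSet_Iic.prod h2), Measure.prod_prod, Measure.prod_prod,
    measure_univ, one_mul, unitInterval.volume_Iic]

theorem probMaxLETie_zero (I : ProphetInstance) (θ : ℝ≥0∞) :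
    I.probMaxLETie θ 0 = I.law {x | (I.maxValue x : ℝ≥0∞) < θ} := by
  have : {x : Fin I.n → ℝ≥0 | (I.maxValue x : ℝ≥0∞) < θ} =
      Set.pi univ fun _ => {x : ℝ≥0 | (x : ℝ≥0∞) < θ} := by
    ext x
    simp only [mem_ofPred_eq, Set.mem_pi, mem_univ, true_implies]
    obtain ⟨i, hi⟩ := I.exists_eq_maxValue x
    exact ⟨fun h j => lt_of_le_of_lt (ENNReal.coe_le_coe.2 (I.le_maxValue x j)) h,
      fun h => hi ▸ h i⟩
  rw [this, law, Measure.pi_pi, probMaxLETie_eq_prod]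
  exact Finset.prod_congr rfl fun j _ => by rw [rejectProb_eq]; simp

/-- Take a `p`-quantile `θ` of the maximum. As `u` runs from `0` to `1`, the probability moves from
`P(max < θ) ≤ p` to `P(max ≤ θ) ≥ p`, and it is a polynomial in `u`, so it attains `p`. -/
theorem exists_probMaxLETie_eq (I : ProphetInstance) {p : ℝ} (h0 : 0 ≤ p) (h1 : p ≤ 1) :
    ∃ (θ : ℝ≥0∞) (u : unitInterval), I.probMaxLETie θ u = ENNReal.ofReal p := by
  have hM : Measurable fun x => (I.maxValue x : ℝ≥0∞) := I.measurable_maxValue.coe_nnreal_ennreal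
  have : IsProbabilityMeasure (I.law.map fun x => (I.maxValue x : ℝ≥0∞)) :=
    Measure.isProbabilityMeasure_map hM.aemeasurable
  obtain ⟨θ, hlo, hhi⟩ := exists_quantile (I.law.map fun x => (I.maxValue x : ℝ≥0∞))
    (p := ENNReal.ofReal p) (by simpa using h1)
  rw [Measure.map_apply hM measurableSet_Iio] at hlo
  rw [Measure.map_apply hM measurableSet_Iic] at hhi
  have hlo' : I.probMaxLETie θ 0 ≤ ENNReal.ofReal p := by rwa [probMaxLETie_zero]
  have hhi' : ENNReal.ofReal p ≤ I.probMaxLETie θ 1 := by rwa [probMaxLETie_one]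
  set G : unitInterval → ℝ := fun u => ∏ j, (((I.F j : Measure ℝ≥0) {x | (x : ℝ≥0∞) < θ}).toReal +
      u * ((I.F j : Measure ℝ≥0) {x | (x : ℝ≥0∞) = θ}).toReal) with hG
  have hGe : ∀ u, I.probMaxLETie θ u = ENNReal.ofReal (G u) := by
    intro u
    have hu : (0 : ℝ) ≤ u := u.2.1
    rw [probMaxLETie_eq_prod, hG, ENNReal.ofReal_prod_of_nonneg fun j _ => by positivity]
    refine Finset.prod_congr rfl fun j _ => ?_
    rw [rejectProb_eq, ENNReal.ofReal_add (by positivity) (by positivity), ENNReal.ofReal_mul hu,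
      ENNReal.ofReal_toReal (measure_ne_top _ _), ENNReal.ofReal_toReal (measure_ne_top _ _)]
  have hG0 : ∀ u, 0 ≤ G u := fun u => Finset.prod_nonneg fun j _ => by
    have hu : (0 : ℝ) ≤ u := u.2.1
    positivity
  have hcont : Continuous G := by
    simp only [hG]
    fun_prop
  rw [hGe, ENNReal.ofReal_le_ofReal_iff h0] at hlo'
  rw [hGe, ENNReal.ofReal_le_ofReal_iff (hG0 1)] at hhi'
  obtain ⟨u, hu⟩ := mem_range_of_exists_le_of_exists_ge hcont ⟨0, hlo'⟩ ⟨1, hhi'⟩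
  exact ⟨θ, u, by rw [hGe, hu]⟩

theorem exists_probMaxLE_eq {I : ProphetInstance} (hI : I.IsContinuous) {p : ℝ}
    (h0 : 0 ≤ p) (h1 : p ≤ 1) : ∃ θ : ℝ≥0∞, I.probMaxLE θ = ENNReal.ofReal p := by
  obtain ⟨θ, u, h⟩ := exists_probMaxLETie_eq I h0 h1
  refine ⟨θ, ?_⟩
  rw [← h, ← probMaxLETie_one, probMaxLETie_eq_prod, probMaxLETie_eq_prod]
  refine Finset.prod_congr rfl fun j _ => ?_
  have hz : (I.F j : Measure ℝ≥0) {x | (x : ℝ≥0∞) = θ} = 0 := by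
    induction θ with
    | top => simp
    | coe θ => simpa using hI j θ
  rw [rejectProb_eq, rejectProb_eq, hz, mul_zero, mul_zero]


/-! ### Hard instances for the upper bound. -/

theorem ProphetInstance.payoff_le_maxValue (I : ProphetInstance) {γ : ℝ≥0} (hγ : γ ≤ 1)
    (π : Equiv.Perm (Fin I.n)) (x : Fin I.n → ℝ≥0) (τ : WithTop (Fin I.n)) :
    I.payoff γ π x τ ≤ I.maxValue x := by
  refine Finset.sup_le fun s _ => ?_
  split_ifs
  · exact (mul_le_of_le_one_left zero_le hγ).trans (I.le_maxValue x _)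
  · exact I.le_maxValue x _
  · exact zero_le

/-- The distribution with value `M` with probability `ε` and value `0` otherwise. -/
noncomputable def twoPoint (ε M : ℝ≥0) : Measure ℝ≥0 :=
  ((1 - ε : ℝ≥0) : ℝ≥0∞) • Measure.dirac 0 + (ε : ℝ≥0∞) • Measure.dirac M

theorem twoPoint_apply (ε M : ℝ≥0) {s : Set ℝ≥0} (hs : MeasurableSet s) :
    twoPoint ε M s = ((1 - ε : ℝ≥0) : ℝ≥0∞) * s.indicator 1 0 + ε * s.indicator 1 M := by
  rw [twoPoint, Measure.add_apply, Measure.smul_apply, Measure.smul_apply,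
    Measure.dirac_apply' _ hs, Measure.dirac_apply' _ hs, smul_eq_mul, smul_eq_mul]

theorem isProbabilityMeasure_twoPoint {ε : ℝ≥0} (M : ℝ≥0) (hε : ε ≤ 1) :
    IsProbabilityMeasure (twoPoint ε M) := ⟨by
  rw [twoPoint_apply ε M MeasurableSet.univ]
  simp only [Set.indicator_univ, Pi.one_apply, mul_one]
  rw [← ENNReal.coe_add, tsub_add_cancel_of_le hε, ENNReal.coe_one]⟩

theorem inv_natCast_sq_le_one (N : ℕ) : ((N : ℝ≥0) ^ 2)⁻¹ ≤ 1 := by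
  rcases Nat.eq_zero_or_pos N with rfl | h
  · simp
  · exact inv_le_one_of_one_le₀ (one_le_pow₀ (by exact_mod_cast h))

/-- The hard instances: the item `k` has the constant value `a`, and the other `N` items have the
value `N` with probability `1 / N ^ 2` and the value `0` otherwise. -/
structure IsHard (a : ℝ≥0) (N : ℕ) (I : ProphetInstance) (k : Fin I.n) : Prop where
  n_eq : I.n = N + 1
  F_self : (I.F k : Measure ℝ≥0) = Measure.dirac a
  F_of_ne : ∀ i, i ≠ k → (I.F i : Measure ℝ≥0) = twoPoint ((N : ℝ≥0) ^ 2)⁻¹ N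

theorem exists_isHard (a : ℝ≥0) (N : ℕ) : ∃ I k, IsHard a N I k := by
  obtain ⟨D, hD⟩ : ∃ D : ProbabilityMeasure ℝ≥0, (D : Measure ℝ≥0) = Measure.dirac a :=
    ⟨⟨Measure.dirac a, inferInstance⟩, rfl⟩
  obtain ⟨T, hT⟩ : ∃ T : ProbabilityMeasure ℝ≥0,
      (T : Measure ℝ≥0) = twoPoint ((N : ℝ≥0) ^ 2)⁻¹ N :=
    ⟨⟨_, isProbabilityMeasure_twoPoint _ (inv_natCast_sq_le_one N)⟩, rfl⟩
  refine ⟨⟨N + 1, N.succ_pos, fun i => if i = 0 then D else T, fun i => ?_⟩,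
    (0 : Fin (N + 1)), rfl, ?_, fun i hi => ?_⟩
  · by_cases hi : i = 0
    · rw [if_pos hi, hD]
      simp
    · rw [if_neg hi, hT, twoPoint, lintegral_add_measure, lintegral_smul_measure,
        lintegral_smul_measure, lintegral_dirac, lintegral_dirac, smul_eq_mul, smul_eq_mul,
        ← ENNReal.coe_mul, ← ENNReal.coe_mul, ← ENNReal.coe_add]
      exact ENNReal.coe_ne_top
  · exact hD
  · change (((if i = 0 then D else T) : ProbabilityMeasure ℝ≥0) : Measure ℝ≥0) = _
    rw [if_neg (by exact hi), hT]

/-- A first hitting time depends only on the decisions made up to that time. If `Q` never holds, its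
minimum is `⊤` and agreement is required everywhere. -/
theorem min_filter_eq {α : Type*} [LinearOrder α] (s : Finset α) (P Q : α → Prop)
    [DecidablePred P] [DecidablePred Q]
    (h : ∀ t : α, (t : WithTop α) ≤ (s.filter Q).min → (P t ↔ Q t)) :
    (s.filter P).min = (s.filter Q).min := by
  refine le_antisymm ?_ (Finset.le_min fun b hb => ?_)
  · rcases hm : (s.filter Q).min with _ | t
    · exact le_top
    · change _ ≤ (t : WithTop α)
      have ht := Finset.mem_filter.1 (Finset.mem_of_min hm)
      exact Finset.min_le (Finset.mem_filter.2 ⟨ht.1, (h t hm.ge).2 ht.2⟩)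
  · by_contra hlt
    have hb' := Finset.mem_filter.1 hb
    exact hlt (Finset.min_le (Finset.mem_filter.2 ⟨hb'.1, (h b (not_le.1 hlt).le).1 hb'.2⟩))

namespace IsHard

variable {a : ℝ≥0} {N : ℕ} {I : ProphetInstance} {k : Fin I.n}

theorem card_erase (h : IsHard a N I k) : (Finset.univ.erase k).card = N := by
  have := h.n_eq
  rw [Finset.card_erase_of_mem (Finset.mem_univ k), Finset.card_univ, Fintype.card_fin]
  omega

theorem ae_values (h : IsHard a N I k) :
    ∀ᵐ x ∂I.law, x k = a ∧ ∀ i, i ≠ k → x i = 0 ∨ x i = (N : ℝ≥0) := by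
  have h0 : ∀ᵐ x ∂I.law, x k = a := by
    refine (Measure.tendsto_eval_ae_ae (μ := fun i => (I.F i : Measure ℝ≥0))
      (i := k)).eventually (p := fun y => y = a) ?_
    rw [h.F_self]
    simp [ae_dirac_eq]
  have h1 : ∀ i, ∀ᵐ x ∂I.law, i ≠ k → x i = 0 ∨ x i = (N : ℝ≥0) := by
    intro i
    by_cases hi : i = k
    · simp [hi]
    have h2 : ∀ᵐ y ∂(I.F i : Measure ℝ≥0), y = 0 ∨ y = (N : ℝ≥0) := by
      rw [h.F_of_ne i hi, ae_iff, twoPoint_apply _ _ (by measurability)]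
      simp
    filter_upwards [(Measure.tendsto_eval_ae_ae (μ := fun i => (I.F i : Measure ℝ≥0))
      (i := i)).eventually h2] with x hx _ using hx
  filter_upwards [h0, ae_all_iff.2 h1] with x hx hx' using ⟨hx, hx'⟩

theorem law_eq (h : IsHard a N I k) (hN : 0 < N) {i : Fin I.n} (hi : i ≠ k) :
    I.law {x | x i = (N : ℝ≥0)} = ((((N : ℝ≥0) ^ 2)⁻¹ : ℝ≥0) : ℝ≥0∞) := by
  have hN' : (N : ℝ≥0) ≠ 0 := by exact_mod_cast hN.ne'
  have := (measurePreserving_eval (fun i => (I.F i : Measure ℝ≥0))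
    i).measure_preimage (s := {(N : ℝ≥0)}) (measurableSet_singleton _).nullMeasurableSet
  refine Eq.trans this ?_
  rw [h.F_of_ne i hi, twoPoint_apply _ _ (measurableSet_singleton _)]
  simp [hN'.symm]

theorem le_opt (h : IsHard a N I k) (hN : 0 < N) (haN : a ≤ N) :
    ENNReal.ofReal (N * (1 + a) / (N + 1)) ≤ I.opt := by
  have hN' : (N : ℝ≥0) ≠ 0 := by exact_mod_cast hN.ne'
  have hNR : (1 : ℝ) ≤ N := by exact_mod_cast hN
  have haR : (a : ℝ) ≤ N := by exact_mod_cast haN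
  -- The event that no large value occurs. The maximum is `N` off `C` and at least `a` on `C`, so
  -- the optimum is at least `N - (N - a) * P(C)`.
  set C : Set (Fin I.n → ℝ≥0) :=
    Set.pi Set.univ fun i => if i = k then Set.univ else {(N : ℝ≥0)}ᶜ with hC
  have hCm : MeasurableSet C := by
    refine MeasurableSet.univ_pi fun i => ?_
    split_ifs <;> measurability
  have hlaw : I.law C = ENNReal.ofReal ((1 - ((N : ℝ) ^ 2)⁻¹) ^ N) := by
    rw [law, hC, Measure.pi_pi, ← Finset.mul_prod_erase _ _ (Finset.mem_univ k)]
    have hs : ∀ i ∈ Finset.univ.erase k, (I.F i : Measure ℝ≥0)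
        (if i = k then Set.univ else {(N : ℝ≥0)}ᶜ) =
        ENNReal.ofReal (1 - ((N : ℝ) ^ 2)⁻¹) := by
      intro i hi
      have hi' := Finset.ne_of_mem_erase hi
      rw [if_neg hi', h.F_of_ne i hi', twoPoint_apply _ _ (by measurability),
        ← ENNReal.ofReal_coe_nnreal, NNReal.coe_sub (inv_natCast_sq_le_one N)]
      simp [hN'.symm]
    rw [Finset.prod_congr rfl hs, Finset.prod_const, h.card_erase, ← ENNReal.ofReal_pow]
    · simp
    · have := inv_natCast_sq_le_one N
      rw [← NNReal.coe_le_coe] at this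
      push_cast at this
      linarith
  -- With `ε = 1 / N ^ 2`, combine `(1 - ε) ^ N * (1 + ε) ^ N ≤ 1` with Bernoulli's `(1 + ε) ^ N ≥ 1
  -- + N * ε`.
  have hbound : (1 - ((N : ℝ) ^ 2)⁻¹) ^ N ≤ N / (N + 1) := by
    have hε : ((N : ℝ) ^ 2)⁻¹ ≤ 1 := inv_le_one_of_one_le₀ (one_le_pow₀ hNR)
    have hε0 : 0 ≤ ((N : ℝ) ^ 2)⁻¹ := by positivity
    have h1 := one_add_mul_le_pow (a := ((N : ℝ) ^ 2)⁻¹) (by linarith) N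
    have h2 : (1 - ((N : ℝ) ^ 2)⁻¹) ^ N * (1 + ((N : ℝ) ^ 2)⁻¹) ^ N ≤ 1 := by
      rw [← mul_pow]
      exact pow_le_one₀ (mul_nonneg (by linarith) (by linarith)) (by nlinarith)
    have h3 : 1 + N * ((N : ℝ) ^ 2)⁻¹ = (N + 1) / N := by field_simp
    rw [h3] at h1
    have h4 : (1 - ((N : ℝ) ^ 2)⁻¹) ^ N * ((N + 1) / N) ≤ 1 :=
      (mul_le_mul_of_nonneg_left h1 (pow_nonneg (by linarith) _)).trans h2
    rw [le_div_iff₀ (by positivity)]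
    have h5 : (1 - ((N : ℝ) ^ 2)⁻¹) ^ N * (N + 1) =
      (1 - ((N : ℝ) ^ 2)⁻¹) ^ N * ((N + 1) / N) * N := by field_simp
    rw [h5]
    nlinarith
  have hint : (N : ℝ≥0∞) ≤ I.opt + ((N - a : ℝ≥0) : ℝ≥0∞) * I.law C := by
    have : ∫⁻ _, (N : ℝ≥0∞) ∂I.law ≤
        ∫⁻ x, ((I.maxValue x : ℝ≥0∞) + C.indicator (fun _ => ((N - a : ℝ≥0) : ℝ≥0∞)) x) ∂I.law := by
      refine lintegral_mono_ae ?_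
      filter_upwards [h.ae_values] with x hx
      by_cases hxC : x ∈ C
      · rw [Set.indicator_of_mem hxC]
        have h1 := I.le_maxValue x k
        rw [hx.1] at h1
        have h2 : (N : ℝ≥0) ≤ I.maxValue x + (N - a) := by
          calc (N : ℝ≥0) = a + (N - a) := (add_tsub_cancel_of_le haN).symm
            _ ≤ _ := by gcongr
        exact_mod_cast h2
      · rw [Set.indicator_of_notMem hxC, add_zero]
        simp only [hC, Set.mem_univ_pi, not_forall] at hxC
        obtain ⟨i, hi⟩ := hxC
        split_ifs at hi with h0
        · simp at hi
        · simp only [Set.mem_compl_iff, Set.mem_singleton_iff, not_not] at hi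
          have := I.le_maxValue x i
          rw [hi] at this
          exact_mod_cast this
    rw [lintegral_const, measure_univ, mul_one, lintegral_add_right _ (measurable_const.indicator hCm),
      lintegral_indicator_const hCm] at this
    exact this
  rw [hlaw] at hint
  have hfin := I.opt_ne_top
  rw [← ENNReal.ofReal_toReal hfin] at hint ⊢
  rw [← ENNReal.ofReal_coe_nnreal, ← ENNReal.ofReal_mul (NNReal.coe_nonneg _),
    ← ENNReal.ofReal_add ENNReal.toReal_nonneg, ← ENNReal.ofReal_natCast,
    ENNReal.ofReal_le_ofReal_iff] at hint
  · refine ENNReal.ofReal_le_ofReal ?_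
    rw [NNReal.coe_sub haN, NNReal.coe_natCast] at hint
    have h1 := mul_le_mul_of_nonneg_left hbound (sub_nonneg.2 haR)
    have h2 : (N : ℝ) * (1 + a) / (N + 1) = N - (N - a) * (N / (N + 1)) := by field_simp; ring
    rw [h2]
    linarith
  · have : (0 : ℝ) ≤ (1 - ((N : ℝ) ^ 2)⁻¹) ^ N :=
      pow_nonneg (sub_nonneg.2 (inv_le_one_of_one_le₀ (one_le_pow₀ hNR))) _
    positivity
  · have : (0 : ℝ) ≤ (1 - ((N : ℝ) ^ 2)⁻¹) ^ N :=
      pow_nonneg (sub_nonneg.2 (inv_le_one_of_one_le₀ (one_le_pow₀ hNR))) _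
    positivity

/-- The reward of any algorithm on a hard instance, compared with its stopping time `σ` when the
items other than `k` turn out to have the value `0`. -/
theorem payoff_le {γ : ℝ≥0} (hγ : γ ≤ 1) (haN : a ≤ N) (A : Algorithm) (ω : I.Seed)
    (π : Equiv.Perm (Fin I.n)) {x : Fin I.n → ℝ≥0} (hxk : x k = a)
    (hx : ∀ i, i ≠ k → x i = 0 ∨ x i = (N : ℝ≥0)) {σ : WithTop (Fin I.n)}
    (hσ : A.stoppingTime I ω π (fun i => if i = k then a else 0) = σ) :
    I.payoff γ π x (A.stoppingTime I ω π x) ≤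
      (γ * a + if σ = (π.symm k : Fin I.n) then (1 - γ) * a else 0) +
        ∑ i ∈ Finset.univ.erase k, (if ((π.symm i : Fin I.n) : WithTop (Fin I.n)) ≤ σ then
          (N : ℝ≥0) * {x : Fin I.n → ℝ≥0 | x i = (N : ℝ≥0)}.indicator 1 x else 0) := by
  set z : Fin I.n → ℝ≥0 := fun i => if i = k then a else 0 with hz
  -- A large value seen no later than `σ` is paid for by its summand `N`. Otherwise the observations
  -- up to `σ` agree with those of the all-zero run, so the algorithm stops at `σ` too.
  by_cases hex : ∃ i, i ≠ k ∧ x i = (N : ℝ≥0) ∧ ((π.symm i : Fin I.n) : WithTop (Fin I.n)) ≤ σ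
  · obtain ⟨i, hik, hxi, hle⟩ := hex
    have hM : I.maxValue x ≤ N := by
      refine Finset.sup_le fun j _ => ?_
      by_cases hj : j = k
      · rw [hj, hxk]; exact haN
      · rcases hx j hj with h | h <;> rw [h]
        exact zero_le
    refine (I.payoff_le_maxValue hγ π x _).trans (hM.trans ?_)
    refine le_add_left (le_trans ?_ (Finset.single_le_sum (fun _ _ => zero_le)
      (Finset.mem_erase.2 ⟨hik, Finset.mem_univ i⟩)))
    rw [if_pos hle, Set.indicator_of_mem (by exact hxi)]
    simp
  · refine le_add_right ?_
    push Not at hex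
    have hagree : ∀ s : Fin I.n, (s : WithTop (Fin I.n)) ≤ σ → x (π s) = z (π s) := by
      intro s hs
      by_cases hk : π s = k
      · simp [hz, hk, hxk]
      · rcases hx _ hk with h0 | h0
        · simp [hz, hk, h0]
        · have := hex _ hk h0
          rw [Equiv.symm_apply_apply] at this
          exact absurd hs (not_le.2 this)
    have hacc : ∀ t : Fin I.n, (t : WithTop (Fin I.n)) ≤ σ →
        A.accept I t ω (I.history π x t) = A.accept I t ω (I.history π z t) := by
      intro t ht
      congr 1
      funext s
      have hs : (s : Fin I.n) ≤ t := s.2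
      exact Prod.ext rfl (hagree s ((WithTop.coe_le_coe.2 hs).trans ht))
    have hτ : A.stoppingTime I ω π x = σ := by
      rw [← hσ]
      refine min_filter_eq _ _ _ fun t ht => ?_
      rw [hacc t (hσ ▸ ht)]
    rw [hτ]
    refine Finset.sup_le fun s _ => ?_
    have hza : ∀ i, z i ≤ a := fun i => by simp only [hz]; split_ifs <;> simp
    by_cases h1 : (s : WithTop (Fin I.n)) < σ
    · rw [if_pos h1, hagree s h1.le]
      exact le_add_right (by gcongr; exact hza _)
    rw [if_neg h1]
    by_cases h2 : (s : WithTop (Fin I.n)) = σ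
    · rw [if_pos h2, hagree s h2.le]
      by_cases h3 : π s = k
      · rw [if_pos (by rw [← h2, ← h3, Equiv.symm_apply_apply]), ← add_mul,
          add_tsub_cancel_of_le hγ, one_mul]
        exact hza _
      · simp [hz, h3]
    · rw [if_neg h2]
      exact zero_le

end IsHard

/-! ### Averaging over the position of the constant item. -/

open ProphetInstance Filter Topology

/-- An upper Riemann sum of `max (c + y) 1` over `[0, 1]`. -/
theorem sum_max_le {N : ℕ} {c : ℝ} (h0 : 0 ≤ c) (hN : 0 < N) :
    ∑ k ∈ Finset.range (N + 1), max (c + k / N) 1 ≤ (N + 1) + N * (c ^ 2 / 2) + c := by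
  have hNR : (0 : ℝ) < N := by exact_mod_cast hN
  -- Up to the factor `N`, an antiderivative of the positive part of `c - 1 + y` at `y = k / N`. The
  -- integrand is nondecreasing, so left endpoint sums telescope to at most the integral; the term
  -- `k = N` is added separately.
  set ψ : ℕ → ℝ := fun k => N * (max 0 (c - 1 + k / N) ^ 2 / 2) with hψ
  have hstep : ∀ k : ℕ, max (c + (k : ℝ) / N) 1 ≤ 1 + (ψ (k + 1) - ψ k) := by
    intro k
    set y : ℝ := c - 1 + k / N with hy
    have e1 : c - 1 + ((k + 1 : ℕ) : ℝ) / N = y + (N : ℝ)⁻¹ := by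
      push_cast; rw [hy]; field_simp; ring
    have e2 : max (c + (k : ℝ) / N) 1 = 1 + max 0 y := by
      rw [← max_add_add_left, max_comm, hy]; ring_nf
    simp only [hψ]
    rw [e1, e2, ← hy]
    have hδ : (0 : ℝ) < (N : ℝ)⁻¹ := by positivity
    have hNδ : (N : ℝ) * (N : ℝ)⁻¹ = 1 := mul_inv_cancel₀ hNR.ne'
    set δ := (N : ℝ)⁻¹
    rcases le_total 0 y with h | h
    · rw [max_eq_right h, max_eq_right (by linarith)]
      have : (N : ℝ) * ((y + δ) ^ 2 / 2) - N * (y ^ 2 / 2) = (N * δ) * y + (N * δ) * δ / 2 := by ring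
      rw [this, hNδ]
      linarith
    · rw [max_eq_left h]
      have : 0 ≤ (N : ℝ) * (max 0 (y + δ) ^ 2 / 2) := by positivity
      simp only [ne_eq, OfNat.ofNat_ne_zero, not_false_eq_true, zero_pow, zero_div, mul_zero]
      linarith
  rw [Finset.sum_range_succ]
  have hsum := Finset.sum_le_sum fun k (_ : k ∈ Finset.range N) => hstep k
  rw [Finset.sum_add_distrib, Finset.sum_range_sub ψ N] at hsum
  simp only [Finset.sum_const, Finset.card_range, nsmul_eq_mul, mul_one] at hsum
  have hψN : ψ N = N * (c ^ 2 / 2) := by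
    simp only [hψ]
    rw [div_self hNR.ne', sub_add_cancel, max_eq_right h0]
  have hψ0 : 0 ≤ ψ 0 := by simp only [hψ]; positivity
  have hlast : max (c + (N : ℝ) / N) 1 = c + 1 := by
    rw [div_self hNR.ne', max_eq_left (by linarith)]
  rw [hlast]
  linarith

namespace IsHard

variable {a : ℝ≥0} {N : ℕ} {I : ProphetInstance} {k : Fin I.n}

/-- Whatever the stopping time `σ` is, its value is at most that of an algorithm that knows the
position of the item `k` and either stops there or never. -/
theorem stop_bound (h : IsHard a N I k) (hN : 0 < N) {b : ℝ≥0} (π : Equiv.Perm (Fin I.n))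
    (σ : WithTop (Fin I.n)) :
    (if σ = (π.symm k : Fin I.n) then b * a else 0) +
      ∑ i ∈ Finset.univ.erase k,
        (if ((π.symm i : Fin I.n) : WithTop (Fin I.n)) ≤ σ then (N : ℝ≥0)⁻¹ else 0) ≤
      max (b * a + (π.symm k : ℕ) / N) 1 := by
  have hN' : (N : ℝ≥0) ≠ 0 := by exact_mod_cast hN.ne'
  rw [← Finset.sum_filter, Finset.sum_const, nsmul_eq_mul, ← div_eq_mul_inv]
  -- If `σ` does not exceed the position of `k`, only the items before `k` can contribute to the
  -- sum. Otherwise there is no bonus for `k`, and all `N` items together contribute at most `1`.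
  by_cases hσ : σ ≤ (π.symm k : Fin I.n)
  · refine le_max_of_le_left (add_le_add (by split_ifs <;> simp) ?_)
    gcongr
    rw [← card_filter_symm_lt π (π.symm k)]
    refine Finset.card_le_card fun i hi => ?_
    simp only [Finset.mem_filter, Finset.mem_erase, Finset.mem_univ, and_true, true_and] at hi ⊢
    refine lt_of_le_of_ne (WithTop.coe_le_coe.1 (hi.2.trans hσ)) fun he => hi.1 ?_
    exact π.symm.injective he
  · rw [if_neg fun he => hσ he.le, zero_add]
    refine le_max_of_le_right ?_
    rw [div_le_one (by positivity)]
    have := Finset.card_filter_le (Finset.univ.erase k)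
      fun i => ((π.symm i : Fin I.n) : WithTop (Fin I.n)) ≤ σ
    rw [h.card_erase] at this
    exact_mod_cast this

theorem expectedReward_le_sum (h : IsHard a N I k) {γ : ℝ≥0} (hγ : γ ≤ 1) (hN : 0 < N)
    (haN : a ≤ N) (A : Algorithm) :
    A.expectedReward γ I ≤ ((∑ π : Equiv.Perm (Fin I.n),
      (γ * a + max ((1 - γ) * a + (π.symm k : ℕ) / N) 1) : ℝ≥0) : ℝ≥0∞) / I.n.factorial := by
  have hN' : (N : ℝ≥0) ≠ 0 := by exact_mod_cast hN.ne'
  have hf0 : (I.n.factorial : ℝ≥0∞) ≠ 0 := by exact_mod_cast I.n.factorial_ne_zero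
  set K := ((∑ π : Equiv.Perm (Fin I.n),
      (γ * a + max ((1 - γ) * a + (π.symm k : ℕ) / N) 1) : ℝ≥0) : ℝ≥0∞) with hK
  -- The bound holds for each fixed seed, so randomization does not help.
  suffices hω : ∀ ω : I.Seed, ∫⁻ x, (∑ π : Equiv.Perm (Fin I.n),
      (I.payoff γ π x (A.stoppingTime I ω π x) : ℝ≥0∞)) / (I.n.factorial : ℝ≥0∞) ∂I.law ≤
      K / I.n.factorial by
    calc A.expectedReward γ I ≤ ∫⁻ _ : I.Seed, K / I.n.factorial := lintegral_mono hω
      _ = K / I.n.factorial := by rw [lintegral_const, measure_univ, mul_one]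
  intro ω
  simp only [div_eq_mul_inv]
  rw [lintegral_mul_const' _ _ (ENNReal.inv_ne_top.2 hf0)]
  refine mul_le_mul_left ?_ _
  set σ : Equiv.Perm (Fin I.n) → WithTop (Fin I.n) := fun π =>
    A.stoppingTime I ω π (fun i => if i = k then a else 0) with hσ
  set B : Equiv.Perm (Fin I.n) → (Fin I.n → ℝ≥0) → ℝ≥0 := fun π x =>
    (γ * a + if σ π = (π.symm k : Fin I.n) then (1 - γ) * a else 0) +
        ∑ i ∈ Finset.univ.erase k, (if ((π.symm i : Fin I.n) : WithTop (Fin I.n)) ≤ σ π then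
          (N : ℝ≥0) * {x : Fin I.n → ℝ≥0 | x i = (N : ℝ≥0)}.indicator 1 x else 0) with hB
  have hS : ∀ i : Fin I.n, MeasurableSet {x : Fin I.n → ℝ≥0 | x i = (N : ℝ≥0)} := fun i =>
    measurableSet_eq_fun (by fun_prop) (by fun_prop)
  have hterm : ∀ π i, Measurable fun x : Fin I.n → ℝ≥0 =>
      (if ((π.symm i : Fin I.n) : WithTop (Fin I.n)) ≤ σ π then
          (N : ℝ≥0) * {x : Fin I.n → ℝ≥0 | x i = (N : ℝ≥0)}.indicator 1 x else 0) := by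
    intro π i
    split_ifs
    · exact (measurable_one.indicator (hS i)).const_mul _
    · exact measurable_const
  have hBm : ∀ π, Measurable (B π) := fun π =>
    measurable_const.add (Finset.measurable_sum _ fun i _ => hterm π i)
  -- A union bound: each other item seen up to `σ π` contributes `N * (1 / N ^ 2) = 1 / N`.
  have hBint : ∀ π, ∫⁻ x, (B π x : ℝ≥0∞) ∂I.law ≤
      ((γ * a + max ((1 - γ) * a + (π.symm k : ℕ) / N) 1 : ℝ≥0) : ℝ≥0∞) := by
    intro π
    have hval : ∫⁻ x, (B π x : ℝ≥0∞) ∂I.law =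
        (((γ * a + if σ π = (π.symm k : Fin I.n) then (1 - γ) * a else 0) +
        ∑ i ∈ Finset.univ.erase k, (if ((π.symm i : Fin I.n) : WithTop (Fin I.n)) ≤ σ π then
          (N : ℝ≥0)⁻¹ else 0) : ℝ≥0) : ℝ≥0∞) := by
      simp only [hB]
      rw [ENNReal.coe_add, ENNReal.ofNNReal_finsetSum]
      simp only [ENNReal.coe_add _ (∑ i ∈ Finset.univ.erase k, _), ENNReal.ofNNReal_finsetSum]
      rw [lintegral_add_left measurable_const, lintegral_const, measure_univ, mul_one,
        lintegral_finsetSum _ fun i _ => (hterm π i).coe_nnreal_ennreal]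
      congr 1
      refine Finset.sum_congr rfl fun i hi => ?_
      split_ifs
      · simp only [ENNReal.coe_mul, ENNReal.coe_indicator]
        have e : ∀ x : Fin I.n → ℝ≥0, {x : Fin I.n → ℝ≥0 | x i = (N : ℝ≥0)}.indicator
          (fun y => ((1 : (Fin I.n → ℝ≥0) → ℝ≥0) y : ℝ≥0∞)) x =
          {x : Fin I.n → ℝ≥0 | x i = (N : ℝ≥0)}.indicator 1 x := fun x => by
            simp [Set.indicator_apply]
        simp only [e]
        rw [lintegral_const_mul _ (measurable_one.indicator (hS i)),
          lintegral_indicator_one (hS i), h.law_eq hN (Finset.ne_of_mem_erase hi),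
          ← ENNReal.coe_mul, ENNReal.coe_inj]
        field_simp
      · simp
    rw [hval, ENNReal.coe_le_coe, add_assoc]
    exact add_le_add_right (h.stop_bound hN π (σ π)) _
  calc ∫⁻ x, ∑ π : Equiv.Perm (Fin I.n),
        (I.payoff γ π x (A.stoppingTime I ω π x) : ℝ≥0∞) ∂I.law
      ≤ ∫⁻ x, ∑ π, (B π x : ℝ≥0∞) ∂I.law := by
        refine lintegral_mono_ae ?_
        filter_upwards [h.ae_values] with x hx
        exact Finset.sum_le_sum fun π _ => ENNReal.coe_le_coe.2
          (payoff_le hγ haN A ω π hx.1 hx.2 rfl)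
    _ = ∑ π, ∫⁻ x, (B π x : ℝ≥0∞) ∂I.law :=
        lintegral_finsetSum _ fun π _ => (hBm π).coe_nnreal_ennreal
    _ ≤ K := by
        rw [hK, ENNReal.ofNNReal_finsetSum]
        exact Finset.sum_le_sum fun π _ => hBint π

theorem expectedReward_le (h : IsHard a N I k) {γ : ℝ≥0} (hγ : γ ≤ 1) (hN : 0 < N)
    (haN : a ≤ N) (A : Algorithm) :
    A.expectedReward γ I ≤ ENNReal.ofReal
      (γ * a + 1 + ((1 - (γ : ℝ)) * a) ^ 2 / 2 + (1 - (γ : ℝ)) * a / N) := by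
  have hNR : (0 : ℝ) < N := by exact_mod_cast hN
  have hγ' : (γ : ℝ) ≤ 1 := by exact_mod_cast hγ
  have hc0 : 0 ≤ (1 - (γ : ℝ)) * a := mul_nonneg (by linarith) a.2
  refine (h.expectedReward_le_sum hγ hN haN A).trans ?_
  have hf : (0 : ℝ) < I.n.factorial := by exact_mod_cast I.n.factorial_pos
  rw [← ENNReal.ofReal_coe_nnreal, ← ENNReal.ofReal_natCast, ← ENNReal.ofReal_div_of_pos hf]
  refine ENNReal.ofReal_le_ofReal ?_
  rw [div_le_iff₀ hf]
  push_cast [NNReal.coe_sub hγ]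
  have hn : (I.n : ℝ) = N + 1 := by rw [h.n_eq]; push_cast; ring
  rw [sum_perm_symm_apply k fun s : Fin I.n =>
    (γ : ℝ) * a + max ((1 - (γ : ℝ)) * a + ((s : ℕ) : ℝ) / N) 1, Finset.sum_add_distrib]
  rw [Fin.sum_univ_eq_sum_range fun s => max ((1 - (γ : ℝ)) * a + (s : ℝ) / N) 1, hn]
  have hs : ∑ s ∈ Finset.range I.n, max ((1 - (γ : ℝ)) * a + (s : ℝ) / N) 1 ≤
      (N + 1) + N * (((1 - (γ : ℝ)) * a) ^ 2 / 2) + (1 - (γ : ℝ)) * a := by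
    rw [h.n_eq]; exact sum_max_le hc0 hN
  simp only [Finset.sum_const, Finset.card_univ, Fintype.card_fin, nsmul_eq_mul, hn]
  set c := (1 - (γ : ℝ)) * a
  rw [div_mul_eq_mul_div, mul_comm _ (I.n.factorial : ℝ), mul_div_assoc]
  refine mul_le_mul_of_nonneg_left ?_ hf.le
  rw [div_le_iff₀ (by positivity)]
  have hcN : c / N * N = c := div_mul_cancel₀ _ hNR.ne'
  have : 0 ≤ c / N := by positivity
  nlinarith [sq_nonneg c]

end IsHard

theorem competitiveRatio_le {γ : ℝ≥0} (hγ : γ ≤ 1) (a : ℝ≥0) (A : Algorithm) :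
    A.competitiveRatio γ ≤
      ENNReal.ofReal ((γ * a + 1 + ((1 - (γ : ℝ)) * a) ^ 2 / 2) / (1 + a)) := by
  -- The bound from the hard instance with `N = 1 / y`; the factor `1 + y` comes from `(N + 1) / N`
  -- in the bound on the optimum. Continuity at `y = 0` gives the limit.
  set g : ℝ → ℝ := fun y =>
    (γ * a + 1 + ((1 - (γ : ℝ)) * a) ^ 2 / 2 + (1 - (γ : ℝ)) * a * y) * (1 + y) / (1 + a) with hg
  have hlim : Tendsto (fun N : ℕ => ENNReal.ofReal (g (1 / (N : ℝ)))) atTop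
      (𝓝 (ENNReal.ofReal ((γ * a + 1 + ((1 - (γ : ℝ)) * a) ^ 2 / 2) / (1 + a)))) := by
    refine ENNReal.tendsto_ofReal ?_
    have hgc : Continuous g := by simp only [hg]; fun_prop
    have := (hgc.tendsto 0).comp tendsto_one_div_atTop_nhds_zero_nat
    simpa [hg, Function.comp_def] using this
  refine ge_of_tendsto hlim ?_
  filter_upwards [eventually_gt_atTop 0, eventually_ge_atTop ⌈a⌉₊] with N hN haN
  have haN' : a ≤ N := Nat.ceil_le.1 haN
  have hNR : (0 : ℝ) < N := by exact_mod_cast hN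
  have ha0 : (0 : ℝ) ≤ a := a.2
  obtain ⟨I, k, h⟩ := exists_isHard a N
  have hopt := h.le_opt hN haN'
  have hpos : (0 : ℝ) < N * (1 + a) / (N + 1) := by positivity
  have hI : I.opt ≠ 0 := ((ENNReal.ofReal_pos.2 hpos).trans_le hopt).ne'
  calc A.competitiveRatio γ ≤ A.expectedReward γ I / I.opt := iInf₂_le I hI
    _ ≤ _ := ENNReal.div_le_div (h.expectedReward_le hγ hN haN' A) hopt
    _ = _ := by
      rw [← ENNReal.ofReal_div_of_pos hpos]
      congr 1
      simp only [hg]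
      field_simp

theorem optimal_constant {γ : ℝ} (h0 : 0 ≤ γ) (h1 : γ ≤ 1) : ∃ a : ℝ, 0 ≤ a ∧
    (γ * a + 1 + ((1 - γ) * a) ^ 2 / 2) / (1 + a) =
      (1 - γ) ^ (3 / 2 : ℝ) * (Real.sqrt (3 - γ) - Real.sqrt (1 - γ)) + γ := by
  rcases h1.eq_or_lt with rfl | h1
  -- For `γ = 1` the quotient is `1` for every `a`.
  · exact ⟨0, le_rfl, by norm_num⟩
  obtain ⟨b, rfl⟩ : ∃ b, γ = 1 - b := ⟨1 - γ, by ring⟩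
  have hb : 0 < b := by linarith
  rw [show 1 - (1 - b) = b by ring, show 3 - (1 - b) = b + 2 by ring]
  have hrpow : b ^ (3 / 2 : ℝ) = b * √b := by
    rw [Real.sqrt_eq_rpow, ← Real.rpow_one_add' hb.le (by norm_num)]; norm_num
  have hs0 : 0 < √b := Real.sqrt_pos.2 hb
  have ht0 : 0 < √(b + 2) := Real.sqrt_pos.2 (by linarith)
  have hs2 : √b ^ 2 = b := Real.sq_sqrt hb.le
  have ht2 : √(b + 2) ^ 2 = b + 2 := Real.sq_sqrt (by linarith)
  have hst : √b ≤ √(b + 2) := Real.sqrt_le_sqrt (by linarith)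
  rw [hrpow]
  generalize √b = s at *
  generalize √(b + 2) = t at *
  subst hs2
  -- In terms of `y = 1 + a` the quotient is `γ - b ^ 2 + b ^ 2 * y / 2 + (b + b ^ 2 / 2) / y`,
  -- which is minimal at `y ^ 2 = (b + 2) / b`.
  refine ⟨t / s - 1, ?_, ?_⟩
  · rw [sub_nonneg, one_le_div hs0]; exact hst
  · have : 1 + (t / s - 1) = t / s := by ring
    rw [this, div_eq_iff (by positivity)]
    have e : s ^ 2 * (t / s - 1) = s * t - s ^ 2 := by field_simp
    rw [e]
    field_simp
    linear_combination (-s ^ 3) * ht2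

theorem competitiveRatio_le_bound {γ : ℝ≥0} (hγ : γ ≤ 1) (A : Algorithm) :
    A.competitiveRatio γ ≤ ENNReal.ofReal ((1 - (γ : ℝ)) ^ (3 / 2 : ℝ) *
        (Real.sqrt (3 - (γ : ℝ)) - Real.sqrt (1 - (γ : ℝ))) + (γ : ℝ)) := by
  obtain ⟨a, ha, he⟩ := optimal_constant γ.2 (by exact_mod_cast hγ)
  lift a to ℝ≥0 using ha
  exact (competitiveRatio_le hγ a A).trans_eq (congrArg ENNReal.ofReal he)

end RandomOrderProphet

open RandomOrderProphet in
theorem theorem3 (γ : ℝ≥0) (hγ : γ ≤ 1) :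
    -- upper bound for every algorithm
    (∀ A : Algorithm, A.competitiveRatio γ ≤
      ENNReal.ofReal ((1 - (γ : ℝ)) ^ (3 / 2 : ℝ) *
        (Real.sqrt (3 - (γ : ℝ)) - Real.sqrt (1 - (γ : ℝ))) + (γ : ℝ))) ∧
    -- the equation that defines `p_γ` has a unique solution
    (∃! p : ℝ, IsPGamma γ p) ∧
    ∀ p : ℝ, IsPGamma γ p →
      -- for continuous distributions there is a threshold with `P(max ≤ θ) = p_γ`
      (∀ I : ProphetInstance, I.IsContinuous → ∃ θ : ℝ≥0∞, I.probMaxLE θ = ENNReal.ofReal p) ∧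
      -- on every instance with such a threshold, the algorithm that accepts the first value
      -- larger than `θ` guarantees the ratio `1 - (1 - γ) p_γ`
      (∀ (I : ProphetInstance) (θ : ℝ≥0∞), I.probMaxLE θ = ENNReal.ofReal p →
        ENNReal.ofReal (1 - (1 - (γ : ℝ)) * p) * I.opt ≤
          (singleThreshold (fun _ => θ) (fun _ => 1)).expectedReward γ I) ∧
      -- for arbitrary distributions there is one with stochastic tie-breaking
      (∀ I : ProphetInstance, ∃ (θ : ℝ≥0∞) (u : unitInterval),
        I.probMaxLETie θ u = ENNReal.ofReal p) ∧
      -- and the single-threshold algorithm has competitive ratio at least `1 - (1 - γ) p_γ`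
      (∀ (θ : ProphetInstance → ℝ≥0∞) (u : ProphetInstance → unitInterval),
        (∀ I : ProphetInstance, I.probMaxLETie (θ I) (u I) = ENNReal.ofReal p) →
        ENNReal.ofReal (1 - (1 - (γ : ℝ)) * p) ≤
          (singleThreshold θ u).competitiveRatio γ) := by
  refine ⟨competitiveRatio_le_bound hγ, existsUnique_isPGamma hγ, fun p hp => ⟨?_, ?_, ?_, ?_⟩⟩
  · exact fun I hI => exists_probMaxLE_eq hI hp.1.le hp.2.1
  · exact fun I θ h => singleThreshold_mul_opt_le hγ hp _ _ I ((I.probMaxLETie_one θ).trans h)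
  · exact fun I => exists_probMaxLETie_eq I hp.1.le hp.2.1
  · exact fun θ u h => le_competitiveRatio_singleThreshold hγ hp θ u h
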